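/- Let $p_0$ be a probability density on $\mathbb{R}$ that is symmetric, $p_0(-x)=p_0(x)$, let $p_\theta(x)=p_0(x-\theta)$, let $\sigma>0$ and $s\ge 0$, and let $\Theta\subset\mathbb{R}$ be compact. The generative mean map kernel (GMMK) with Gaussian base kernel, restricted to this location family, is $$k(\theta,\theta')=\int\!\!\int p_\theta(x)\,p_{\theta'}(x')\;s\,\exp\!\Big(-\frac{(x-x')^2}{2\sigma^2}\Big)\,dx\,dx',\qquad \theta,\theta'\in\Theta .$$ The height is normalized so that $s\le 1$ (for instance $s=1$, the Gaussian RBF kernel) or, more generally, so that $k(\theta,\theta)<1$; this number does not depend on $\theta$. Let $\mathcal H$ be the reproducing kernel Hilbert space of $k$ on $\Theta$ and $B_{\mathcal H}$ its closed unit ball. Let $\mathcal N(B_{\mathcal H},\|\cdot\|_\infty,\eta)$ be the least number of closed balls of radius $\eta$ in $C(\Theta)$ with the sup norm that cover the image of $B_{\mathcal H}$ under the inclusion $\mathcal H\to C(\Theta)$. Let $Y=\{-1,1\}$. For a probability measure $Q$ on $\Theta\times Y$ and $f\in\mathcal H$ let $\mathcal R_Q(f)=\mathsf E_{(\theta,y)\sim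 Q}\max\{0,1-yf(\theta)\}$ be the hinge risk. Put $\mathcal R^*_{Q,\mathcal H}=\inf_{f\in\mathcal H}\mathcal R_Q(f)$ and $A_2(\lambda)=\inf_{f\in\mathcal H}\big(\lambda\|f\|_{\mathcal H}^2+\mathcal R_P(f)-\mathcal R^*_{P,\mathcal H}\big)$. Then there is a constant $c_k>0$, depending only on the kernel $k$ on $\Theta\times\Theta$, such that the following hold. 1. (Covering numbers.) For all $\lambda>0$ and $\epsilon>0$ the number $\mathcal N(B_{\mathcal H},\|\cdot\|_\infty,\lambda^{1/2}\epsilon)$ is finite and $$\ln\mathcal N(B_{\mathcal H},\|\cdot\|_\infty,\lambda^{1/2}\epsilon)\le c_k\Big(\ln\frac1{\lambda^{1/2}\epsilon}\Big)^2 .$$ 2. (Generalization of SVMs.) Let $P$ be any probability measure on $\Theta\times Y$. Then $A_2(\lambda)\to0$ as $\lambda\downarrow0$. Let $\lambda>0$ and $n\ge1$. For every sample in $(\Theta\times Y)^n$ with empirical distribution $D$, the functional $f\mapsto\lambda\|f\|^2_{\mathcal H}+\mathcal R_D(f)$ has a unique minimizer $f_{D,\lambda}$ in $\mathcal H$. Moreover,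 for all $\epsilon>0$ and $\tau>0$, if the sample is drawn from $P^n$, then with probability greater than $1-e^{-\tau}$ $$\lambda\|f_{D,\lambda}\|^2_{\mathcal H}+\mathcal R_P(f_{D,\lambda})-\mathcal R^*_{P,\mathcal H}<A_2(\lambda)+4\epsilon+(\lambda^{-1/2}+1)\sqrt{\frac{2\tau+2\ln\big(2\,\mathcal N(B_{\mathcal H},\|\cdot\|_\infty,\lambda^{1/2}\epsilon)\big)}{n}},$$ and likewise, with probability greater than $1-e^{-\tau}$, $$\lambda\|f_{D,\lambda}\|^2_{\mathcal H}+\mathcal R_P(f_{D,\lambda})-\mathcal R^*_{P,\mathcal H}<A_2(\lambda)+4\epsilon+(\lambda^{-1/2}+1)\sqrt{\frac{2\tau+2\ln2+2c_k\big(\ln\frac1{\lambda^{1/2}\epsilon}\big)^2}{n}} .$$ -/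

import Mathlib

open MeasureTheory ProbabilityTheory Filter Topology
open scoped NNReal ENNReal RealInnerProductSpace

noncomputable section

/-- A symmetric probability density on the real line. -/
structure SymmetricDensity where
  toFun : ℝ → ℝ
  measurable : Measurable toFun
  nonneg : ∀ x, 0 ≤ toFun x
  integral_eq_one : ∫ x, toFun x = 1
  symm : ∀ x, toFun (-x) = toFun x

namespace SymmetricDensity

/-- The member with location parameter `θ` of the location family generated by `p`. -/
def shift (p : SymmetricDensity) (θ : ℝ) : ℝ → ℝ := fun x => p.toFun (x - θ)

theorem integrable (p : SymmetricDensity) : Integrable p.toFun := by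
  by_contra h
  have := p.integral_eq_one
  rw [integral_undef h] at this
  exact zero_ne_one this

end SymmetricDensity

/-- The Gaussian radial basis function kernel of bandwidth `σ` and height `s`. -/
def gaussianRBF (s : ℝ≥0) (σ : ℝ) (x x' : ℝ) : ℝ :=
  s * Real.exp (-(x - x') ^ 2 / (2 * σ ^ 2))

/-- The generative mean map kernel of the densities `p` and `q`, with base kernel `κ`. -/
def gmmk (κ : ℝ → ℝ → ℝ) (p q : ℝ → ℝ) : ℝ :=
  ∫ x, ∫ x', p x * q x' * κ x x'

/-- The generative mean map kernel with Gaussian base kernel, as a kernel on location parameters. -/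
def locKernel (p : SymmetricDensity) (s : ℝ≥0) (σ : ℝ) (θ θ' : ℝ) : ℝ :=
  gmmk (gaussianRBF s σ) (p.shift θ) (p.shift θ')

/-! ### Positive definiteness and continuity of the kernel -/

namespace SymmetricDensity

def cosT (p : SymmetricDensity) (θ ω : ℝ) : ℝ := ∫ x, p.toFun x * Real.cos (ω * (x + θ))

def sinT (p : SymmetricDensity) (θ ω : ℝ) : ℝ := ∫ x, p.toFun x * Real.sin (ω * (x + θ))

theorem integrable_mul (p : SymmetricDensity) {g : ℝ → ℝ} (hg : Continuous g)
    (hb : ∀ x, |g x| ≤ 1) : Integrable (fun x => p.toFun x * g x) := by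
  refine p.integrable.mul_bdd (c := 1) hg.aestronglyMeasurable ?_
  exact Eventually.of_forall fun x => by simpa using hb x

theorem continuous_cosT (p : SymmetricDensity) :
    Continuous (fun q : ℝ × ℝ => p.cosT q.1 q.2) := by
  unfold cosT
  refine continuous_of_dominated (bound := p.toFun) (fun q => ?_) (fun q => ?_) p.integrable ?_
  · exact (p.integrable_mul (by fun_prop) fun x => Real.abs_cos_le_one _).aestronglyMeasurable
  · refine Eventually.of_forall fun x => ?_
    rw [norm_mul, Real.norm_of_nonneg (p.nonneg x)]
    exact mul_le_of_le_one_right (p.nonneg x) (Real.abs_cos_le_one _)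
  · exact Eventually.of_forall fun x => by fun_prop

theorem continuous_sinT (p : SymmetricDensity) :
    Continuous (fun q : ℝ × ℝ => p.sinT q.1 q.2) := by
  unfold sinT
  refine continuous_of_dominated (bound := p.toFun) (fun q => ?_) (fun q => ?_) p.integrable ?_
  · exact (p.integrable_mul (by fun_prop) fun x => Real.abs_sin_le_one _).aestronglyMeasurable
  · refine Eventually.of_forall fun x => ?_
    rw [norm_mul, Real.norm_of_nonneg (p.nonneg x)]
    exact mul_le_of_le_one_right (p.nonneg x) (Real.abs_sin_le_one _)
  · exact Eventually.of_forall fun x => by fun_prop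

theorem abs_cosT_le (p : SymmetricDensity) (θ ω : ℝ) : |p.cosT θ ω| ≤ 1 := by
  rw [← p.integral_eq_one, ← Real.norm_eq_abs]
  refine norm_integral_le_of_norm_le p.integrable (Eventually.of_forall fun x => ?_)
  rw [norm_mul, Real.norm_of_nonneg (p.nonneg x)]
  exact mul_le_of_le_one_right (p.nonneg x) (Real.abs_cos_le_one _)

theorem abs_sinT_le (p : SymmetricDensity) (θ ω : ℝ) : |p.sinT θ ω| ≤ 1 := by
  rw [← p.integral_eq_one, ← Real.norm_eq_abs]
  refine norm_integral_le_of_norm_le p.integrable (Eventually.of_forall fun x => ?_)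
  rw [norm_mul, Real.norm_of_nonneg (p.nonneg x)]
  exact mul_le_of_le_one_right (p.nonneg x) (Real.abs_sin_le_one _)

end SymmetricDensity

/-- The spectral measure of the Gaussian kernel of bandwidth `σ`. -/
def specMeasure (σ : ℝ) : Measure ℝ := gaussianReal 0 (Real.toNNReal (1 / σ ^ 2))

instance (σ : ℝ) : IsProbabilityMeasure (specMeasure σ) := by
  unfold specMeasure; infer_instance

theorem integral_cos_specMeasure (σ t : ℝ) :
    ∫ ω, Real.cos (ω * t) ∂(specMeasure σ) = Real.exp (-t ^ 2 / (2 * σ ^ 2)) := by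
  have h := charFun_gaussianReal (μ := 0) (v := Real.toNNReal (1 / σ ^ 2)) t
  rw [charFun_apply_real] at h
  have h2 := congrArg Complex.re h
  have hi : Integrable (fun x : ℝ => Complex.exp (t * x * Complex.I))
      (gaussianReal 0 (Real.toNNReal (1 / σ ^ 2))) := by
    refine Integrable.mono' (integrable_const (1 : ℝ)) ?_ ?_
    · exact Continuous.aestronglyMeasurable (by fun_prop)
    · refine Eventually.of_forall fun x => ?_
      rw [← Complex.ofReal_mul, Complex.norm_exp_ofReal_mul_I]
  rw [← RCLike.re_eq_complex_re, ← integral_re hi] at h2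
  have e1 : ∀ x : ℝ, RCLike.re (Complex.exp (t * x * Complex.I)) = Real.cos (x * t) := by
    intro x
    rw [← Complex.ofReal_mul, RCLike.re_eq_complex_re, Complex.exp_ofReal_mul_I_re, mul_comm]
  simp only [e1] at h2
  unfold specMeasure
  rw [h2, Real.coe_toNNReal _ (by positivity)]
  have e2 : (t : ℂ) * (0 : ℝ) * Complex.I - ((1 / σ ^ 2 : ℝ) : ℂ) * t ^ 2 / 2
      = ((-t ^ 2 / (2 * σ ^ 2) : ℝ) : ℂ) := by
    have : -t ^ 2 / (2 * σ ^ 2) = -((1 / σ ^ 2) * t ^ 2 / 2) := by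
      rw [one_div, div_eq_mul_inv, mul_inv]; ring
    rw [this]; push_cast; ring
  rw [e2, RCLike.re_eq_complex_re, Complex.exp_ofReal_re]

theorem locKernel_eq (p : SymmetricDensity) (s : ℝ≥0) (σ θ θ' : ℝ) :
    locKernel p s σ θ θ' = s * ∫ ω, (p.cosT θ ω * p.cosT θ' ω + p.sinT θ ω * p.sinT θ' ω)
      ∂(specMeasure σ) := by
  have h0 : locKernel p s σ θ θ' = s * ∫ x, ∫ y, ∫ ω, p.toFun x * p.toFun y *
      Real.cos (ω * ((x + θ) - (y + θ'))) ∂(specMeasure σ) := by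
    unfold locKernel gmmk gaussianRBF SymmetricDensity.shift
    rw [← integral_const_mul, ← integral_add_right_eq_self _ θ]
    congr 1; ext x
    rw [← integral_const_mul, ← integral_add_right_eq_self _ θ']
    congr 1; ext y
    rw [integral_const_mul, integral_cos_specMeasure]
    simp only [add_sub_cancel_right]; ring
  rw [h0]
  congr 1
  have hxyω : Integrable (fun q : ℝ × (ℝ × ℝ) => p.toFun q.1 * p.toFun q.2.1 *
      Real.cos (q.2.2 * ((q.1 + θ) - (q.2.1 + θ'))))
      (volume.prod (volume.prod (specMeasure σ))) := by
    have := p.integrable.mul_prod (p.integrable.mul_prod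
      (integrable_const (μ := specMeasure σ) (1 : ℝ)))
    simp only [mul_one] at this
    refine (this.mul_bdd (c := 1) (g := fun q : ℝ × (ℝ × ℝ) =>
      Real.cos (q.2.2 * ((q.1 + θ) - (q.2.1 + θ')))) ?_ ?_)
    · exact Continuous.aestronglyMeasurable (by fun_prop)
    · exact Eventually.of_forall fun q => Real.abs_cos_le_one _
  have hyω : ∀ x, Integrable (fun q : ℝ × ℝ => p.toFun x * p.toFun q.1 *
      Real.cos (q.2 * ((x + θ) - (q.1 + θ')))) (volume.prod (specMeasure σ)) := by
    intro x
    have := (p.integrable.mul_prod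
      (integrable_const (μ := specMeasure σ) (1 : ℝ))).const_mul (p.toFun x)
    simp only [mul_one] at this
    refine (this.mul_bdd (c := 1) (g := fun q : ℝ × ℝ =>
      Real.cos (q.2 * ((x + θ) - (q.1 + θ')))) ?_ ?_)
    · exact Continuous.aestronglyMeasurable (by fun_prop)
    · exact Eventually.of_forall fun q => Real.abs_cos_le_one _
  have h1 : ∀ x, ∫ y, ∫ ω, p.toFun x * p.toFun y *
      Real.cos (ω * ((x + θ) - (y + θ'))) ∂(specMeasure σ) =
      ∫ ω, (p.toFun x * Real.cos (ω * (x + θ)) * p.cosT θ' ω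
        + p.toFun x * Real.sin (ω * (x + θ)) * p.sinT θ' ω) ∂(specMeasure σ) := by
    intro x
    rw [integral_integral_swap (hyω x)]
    congr 1; ext ω
    unfold SymmetricDensity.cosT SymmetricDensity.sinT
    rw [← integral_const_mul, ← integral_const_mul, ← integral_add]
    · congr 1; ext y
      rw [mul_sub, Real.cos_sub]; ring
    · exact (p.integrable_mul (by fun_prop) fun x => Real.abs_cos_le_one _).const_mul _
    · exact (p.integrable_mul (by fun_prop) fun x => Real.abs_sin_le_one _).const_mul _
  simp only [h1]
  rw [integral_integral_swap]
  · congr 1; ext ω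
    rw [integral_add, integral_mul_const, integral_mul_const]
    · rfl
    · exact (p.integrable_mul (by fun_prop) fun x => Real.abs_cos_le_one _).mul_const _
    · exact (p.integrable_mul (by fun_prop) fun x => Real.abs_sin_le_one _).mul_const _
  · have hp : Integrable (fun q : ℝ × ℝ => p.toFun q.1) (volume.prod (specMeasure σ)) := by
      simpa using p.integrable.mul_prod (integrable_const (μ := specMeasure σ) (1 : ℝ))
    have hc := p.continuous_cosT.comp (f := fun q : ℝ × ℝ => (θ', q.2)) (by fun_prop)
    have hs := p.continuous_sinT.comp (f := fun q : ℝ × ℝ => (θ', q.2)) (by fun_prop)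
    have : Integrable (fun q : ℝ × ℝ => p.toFun q.1 * (Real.cos (q.2 * (q.1 + θ)) * p.cosT θ' q.2
        + Real.sin (q.2 * (q.1 + θ)) * p.sinT θ' q.2)) (volume.prod (specMeasure σ)) := by
      refine hp.mul_bdd (c := 2) ?_ ?_
      · refine Continuous.aestronglyMeasurable ?_
        exact (Continuous.mul (by fun_prop) hc).add (Continuous.mul (by fun_prop) hs)
      · refine Eventually.of_forall fun q => (norm_add_le _ _).trans ?_
        rw [norm_mul, norm_mul]
        have a1 := mul_le_one₀ (Real.abs_cos_le_one (q.2 * (q.1 + θ))) (abs_nonneg _)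
          (p.abs_cosT_le θ' q.2)
        have a2 := mul_le_one₀ (Real.abs_sin_le_one (q.2 * (q.1 + θ))) (abs_nonneg _)
          (p.abs_sinT_le θ' q.2)
        simp only [Real.norm_eq_abs]
        linarith
    refine this.congr (Eventually.of_forall fun q => ?_)
    simp only [Function.uncurry]
    ring

theorem continuous_locKernel (p : SymmetricDensity) (s : ℝ≥0) (σ : ℝ) :
    Continuous (fun q : ℝ × ℝ => locKernel p s σ q.1 q.2) := by
  simp only [locKernel_eq]
  refine continuous_const.mul ?_
  have c1 : ∀ ω, Continuous (fun θ => p.cosT θ ω) := fun ω =>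
    p.continuous_cosT.comp (f := fun θ : ℝ => (θ, ω)) (by fun_prop)
  have c2 : ∀ ω, Continuous (fun θ => p.sinT θ ω) := fun ω =>
    p.continuous_sinT.comp (f := fun θ : ℝ => (θ, ω)) (by fun_prop)
  have d1 : ∀ θ, Continuous (fun ω => p.cosT θ ω) := fun θ =>
    p.continuous_cosT.comp (f := fun ω : ℝ => (θ, ω)) (by fun_prop)
  have d2 : ∀ θ, Continuous (fun ω => p.sinT θ ω) := fun θ =>
    p.continuous_sinT.comp (f := fun ω : ℝ => (θ, ω)) (by fun_prop)
  refine continuous_of_dominated (bound := fun _ => 2) (fun q => ?_) (fun q => ?_)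
    (integrable_const _) ?_
  · exact (((d1 q.1).mul (d1 q.2)).add ((d2 q.1).mul (d2 q.2))).aestronglyMeasurable
  · refine Eventually.of_forall fun ω => (norm_add_le _ _).trans ?_
    rw [norm_mul, norm_mul]
    have a1 := mul_le_one₀ (p.abs_cosT_le q.1 ω) (abs_nonneg _) (p.abs_cosT_le q.2 ω)
    have a2 := mul_le_one₀ (p.abs_sinT_le q.1 ω) (abs_nonneg _) (p.abs_sinT_le q.2 ω)
    simp only [Real.norm_eq_abs]
    linarith
  · refine Eventually.of_forall fun ω => ?_
    exact (((c1 ω).comp continuous_fst).mul ((c1 ω).comp continuous_snd)).add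
      (((c2 ω).comp continuous_fst).mul ((c2 ω).comp continuous_snd))

/-! ### The reproducing kernel Hilbert space -/

/-- The kernel restricted to `Θ`, as a matrix of (one-dimensional) operators. -/
def gmmkMatrix (p : SymmetricDensity) (s : ℝ≥0) (σ : ℝ) (Θ : Set ℝ) :
    Matrix Θ Θ (ℝ →L[ℝ] ℝ) :=
  .of fun θ θ' => locKernel p s σ θ θ' • ContinuousLinearMap.id ℝ ℝ

theorem locKernel_comm (p : SymmetricDensity) (s : ℝ≥0) (σ : ℝ) (θ θ' : ℝ) :
    locKernel p s σ θ θ' = locKernel p s σ θ' θ := by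
  simp only [locKernel_eq, mul_comm]

theorem gmmkMatrix_posSemidef (p : SymmetricDensity) (s : ℝ≥0) (σ : ℝ) (Θ : Set ℝ) :
    (gmmkMatrix p s σ Θ).PosSemidef := by
  have T := RKHS.posSemidef_tfae (K := gmmkMatrix p s σ Θ)
  refine (T.out 0 2 rfl rfl).mpr ⟨?_, fun v => ?_⟩
  · ext θ θ'
    simp [gmmkMatrix, locKernel_comm p s σ θ' θ, ContinuousLinearMap.star_eq_adjoint,
      ContinuousLinearMap.adjoint_id]
  · have e : v.sum (fun x w => v.sum fun x' w' => ⟪gmmkMatrix p s σ Θ x' x w, w'⟫) =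
        s * ∫ ω, ((v.sum fun x w => w * p.cosT x ω) ^ 2 + (v.sum fun x w => w * p.sinT x ω) ^ 2)
          ∂(specMeasure σ) := by
      have d1 : ∀ θ, Continuous (fun ω => p.cosT θ ω) := fun θ =>
        p.continuous_cosT.comp (f := fun ω : ℝ => (θ, ω)) (by fun_prop)
      have d2 : ∀ θ, Continuous (fun ω => p.sinT θ ω) := fun θ =>
        p.continuous_sinT.comp (f := fun ω : ℝ => (θ, ω)) (by fun_prop)
      have hi : ∀ θ θ' : ℝ, Integrable (fun ω => p.cosT θ ω * p.cosT θ' ω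
          + p.sinT θ ω * p.sinT θ' ω) (specMeasure σ) := by
        intro θ θ'
        refine Integrable.mono' (integrable_const (2 : ℝ)) ?_ ?_
        · exact (((d1 _).mul (d1 _)).add ((d2 _).mul (d2 _))).aestronglyMeasurable
        · refine Eventually.of_forall fun ω => (norm_add_le _ _).trans ?_
          rw [norm_mul, norm_mul]
          have a1 := mul_le_one₀ (p.abs_cosT_le θ ω) (abs_nonneg _) (p.abs_cosT_le θ' ω)
          have a2 := mul_le_one₀ (p.abs_sinT_le θ ω) (abs_nonneg _) (p.abs_sinT_le θ' ω)
          simp only [Real.norm_eq_abs]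
          linarith
      have e2 : ∀ ω, (v.sum fun x w => w * p.cosT x ω) ^ 2 + (v.sum fun x w => w * p.sinT x ω) ^ 2
          = ∑ x ∈ v.support, ∑ x' ∈ v.support, v x * v x' *
            (p.cosT x' ω * p.cosT x ω + p.sinT x' ω * p.sinT x ω) := by
        intro ω
        simp only [Finsupp.sum, sq, Finset.sum_mul_sum, ← Finset.sum_add_distrib]
        refine Finset.sum_congr rfl fun x _ => Finset.sum_congr rfl fun x' _ => ?_
        ring
      have e3 : ∫ ω, (∑ x ∈ v.support, ∑ x' ∈ v.support, v x * v x' *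
            (p.cosT x' ω * p.cosT x ω + p.sinT x' ω * p.sinT x ω)) ∂(specMeasure σ) =
          ∑ x ∈ v.support, ∑ x' ∈ v.support, v x * v x' *
            ∫ ω, (p.cosT x' ω * p.cosT x ω + p.sinT x' ω * p.sinT x ω) ∂(specMeasure σ) := by
        refine (integral_finsetSum _ fun (x : Θ) _ => integrable_finsetSum _ fun (x' : Θ) _ =>
          (hi x' x).const_mul (v x * v x')).trans ?_
        refine Finset.sum_congr rfl fun x _ => ?_
        refine (integral_finsetSum _ fun (x' : Θ) _ => (hi x' x).const_mul (v x * v x')).trans ?_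
        refine Finset.sum_congr rfl fun x' _ => ?_
        exact integral_const_mul _ _
      simp only [e2]
      rw [e3, Finset.mul_sum]
      simp only [Finsupp.sum]
      refine Finset.sum_congr rfl fun x _ => ?_
      rw [Finset.mul_sum]
      refine Finset.sum_congr rfl fun x' _ => ?_
      simp only [gmmkMatrix, Matrix.of_apply, locKernel_eq]
      simp
      ring
    rw [e]
    simp only [RCLike.re_to_real]
    refine mul_nonneg s.2 (integral_nonneg fun ω => ?_)
    positivity

instance (p : SymmetricDensity) (s : ℝ≥0) (σ : ℝ) (Θ : Set ℝ) :
    Fact (gmmkMatrix p s σ Θ).PosSemidef := ⟨gmmkMatrix_posSemidef p s σ Θ⟩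

/-- The reproducing kernel Hilbert space of the kernel restricted to `Θ`. -/
abbrev GmmkRKHS (p : SymmetricDensity) (s : ℝ≥0) (σ : ℝ) (Θ : Set ℝ) : Type :=
  RKHS.OfKernel (gmmkMatrix p s σ Θ)

section

variable {p : SymmetricDensity} {s : ℝ≥0} {σ : ℝ} {Θ : Set ℝ}

theorem GmmkRKHS.continuous_coe (f : GmmkRKHS p s σ Θ) : Continuous (fun θ : Θ => f θ) := by
  have hin : ∀ θ θ' : Θ, ⟪RKHS.kerFun (GmmkRKHS p s σ Θ) θ (1 : ℝ),
      RKHS.kerFun (GmmkRKHS p s σ Θ) θ' (1 : ℝ)⟫ = locKernel p s σ θ' θ := by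
    intro θ θ'
    rw [← RKHS.kernel_inner, RKHS.OfKernel.kernel_ofKernel]
    simp [gmmkMatrix]
  have hk : Continuous (fun θ : Θ => RKHS.kerFun (GmmkRKHS p s σ Θ) θ (1 : ℝ)) := by
    rw [continuous_iff_continuousAt]
    intro θ₀
    rw [ContinuousAt, tendsto_iff_norm_sub_tendsto_zero]
    have hn : ∀ θ : Θ, ‖RKHS.kerFun (GmmkRKHS p s σ Θ) θ (1 : ℝ) -
        RKHS.kerFun (GmmkRKHS p s σ Θ) θ₀ (1 : ℝ)‖ =
        √(locKernel p s σ θ θ - 2 * locKernel p s σ θ₀ θ + locKernel p s σ θ₀ θ₀) := by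
      intro θ
      rw [← hin, ← hin, ← hin, real_inner_self_eq_norm_sq, real_inner_self_eq_norm_sq,
        ← norm_sub_sq_real, Real.sqrt_sq (norm_nonneg _)]
    simp only [hn]
    have c := continuous_locKernel p s σ
    have c1 : Continuous fun θ : Θ => locKernel p s σ θ θ :=
      c.comp (f := fun θ : Θ => ((θ : ℝ), (θ : ℝ))) (by fun_prop)
    have c2 : Continuous fun θ : Θ => locKernel p s σ θ₀ θ :=
      c.comp (f := fun θ : Θ => ((θ₀ : ℝ), (θ : ℝ))) (by fun_prop)
    have c3 : Continuous fun θ : Θ =>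
        √(locKernel p s σ θ θ - 2 * locKernel p s σ θ₀ θ + locKernel p s σ θ₀ θ₀) := by
      fun_prop
    have := c3.tendsto θ₀
    convert this using 2
    rw [show locKernel p s σ θ₀ θ₀ - 2 * locKernel p s σ θ₀ θ₀ + locKernel p s σ θ₀ θ₀ = 0 by ring,
      Real.sqrt_zero]
  have : (fun θ : Θ => f θ) =
      fun θ : Θ => ⟪RKHS.kerFun (GmmkRKHS p s σ Θ) θ (1 : ℝ), f⟫ := by
    ext θ
    rw [RKHS.kerFun_inner]
    simp
  rw [this]
  exact hk.inner continuous_const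

/-- The inclusion of the reproducing kernel Hilbert space into `C(Θ)`. -/
def inclusion (f : GmmkRKHS p s σ Θ) : C(Θ, ℝ) := ⟨fun θ => f θ, f.continuous_coe⟩

variable (p s σ Θ) in
/-- The covering number `N(B_H, ‖·‖_∞, η)` of the unit ball of the reproducing kernel Hilbert
space: the least number of closed sup-norm balls of radius `η` in `C(Θ)` that cover it. -/
def ballCoveringNumber [CompactSpace Θ] (η : ℝ) : ℕ∞ :=
  Metric.externalCoveringNumber η.toNNReal
    (inclusion '' Metric.closedBall (0 : GmmkRKHS p s σ Θ) 1)

/-! ### Support vector machines -/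

/-- The set of labels. -/
def Label : Set ℝ := {-1, 1}

def hinge (y t : ℝ) : ℝ := max 0 (1 - y * t)

/-- The risk of `f` for the hinge loss. -/
def risk (Q : Measure (Θ × Label)) (f : GmmkRKHS p s σ Θ) : ℝ :=
  ∫ z, hinge z.2 (f z.1) ∂Q

/-- The regularized risk. -/
def regRisk (reg : ℝ) (Q : Measure (Θ × Label)) (f : GmmkRKHS p s σ Θ) : ℝ :=
  reg * ‖f‖ ^ 2 + risk Q f

variable (p s σ) in
/-- The smallest risk over the reproducing kernel Hilbert space. -/
def minRisk (Q : Measure (Θ × Label)) : ℝ := ⨅ f : GmmkRKHS p s σ Θ, risk Q f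

variable (p s σ) in
/-- The approximation error functional. -/
def approxError (Q : Measure (Θ × Label)) (reg : ℝ) : ℝ :=
  ⨅ f : GmmkRKHS p s σ Θ, (regRisk reg Q f - minRisk p s σ Q)

/-- The empirical distribution of a sample. -/
def empirical {n : ℕ} (z : Fin n → Θ × Label) : Measure (Θ × Label) :=
  (n : ℝ≥0∞)⁻¹ • ∑ i, Measure.dirac (z i)

/-- `f` solves the SVM problem with regularization parameter `reg` for the distribution `Q`. -/
def IsSVMSolution (reg : ℝ) (Q : Measure (Θ × Label)) (f : GmmkRKHS p s σ Θ) : Prop :=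
  ∀ g : GmmkRKHS p s σ Θ, regRisk reg Q f ≤ regRisk reg Q g

end

end

/-! Entropy. By the spectral formula `locKernel_eq`, a finite combination of kernel sections is a
Fourier integral in `θ` against the Gaussian spectral measure, and its squared RKHS norm is `s`
times the integral of the squared amplitude (`norm_kerComb_sq`). The spectral measure has all
exponential moments, so the integral can be expanded in powers of `θ / R` on `Θ ⊆ [-R, R]`, with
coefficients bounded by one constant `C` and a remainder at most `C * 2⁻ᵐ`
(`exists_geometric_approx_fourier`, `exists_geometric_approx_kerComb`). Density of the combinations
extends this to the unit ball up to an arbitrarily small error. About `log (1/η)` coefficients, each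
rounded to polynomially many values in `1/η`, then describe a function up to `η`; this is the
squared logarithm (`exists_isCover_of_geometric_approx`).

The bound carries no additive constant, so it forces a single ball to suffice for `η` near 1 and
above. This is where `k(θ,θ) < 1` enters: the ball of radius `√k(θ,θ)` about 0 already covers, and
below a threshold smaller than 1 the quantity `log (1/η)` is bounded away from 0 and absorbs the
constants.

Generalization. Comparison with the zero function puts every SVM solution in the ball of radius
`λ^(-1/2)`. A net of the unit ball at scale `λ^(1/2) ε`, rescaled, is an `ε`-net of that ball.
Hoeffding's inequality at each net point and a union bound control the deviation between true and
empirical risk uniformly (`measure_not_oracle_lt`); applied to the empirical and to the population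
minimizer, this gives the oracle inequality (`regRisk_sub_minRisk_le`). -/

/-! ### Minimizers of regularized functionals. -/

/-- The squared norm makes the functional strongly convex: by the parallelogram law, two
near-minimizers are close to each other. Minimizing sequences are therefore Cauchy, and no weak
compactness is needed. -/
theorem existsUnique_minimizer_sq_norm_add {H : Type*} [NormedAddCommGroup H]
    [InnerProductSpace ℝ H] [CompleteSpace H] {φ : H → ℝ} (hφ : Continuous φ)
    (h0 : ∀ f, 0 ≤ φ f)
    (hmid : ∀ f g, φ ((1 / 2 : ℝ) • (f + g)) ≤ (φ f + φ g) / 2) {r : ℝ} (hr : 0 < r) :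
    ∃! f, ∀ g, r * ‖f‖ ^ 2 + φ f ≤ r * ‖g‖ ^ 2 + φ g := by
  set J : H → ℝ := fun f => r * ‖f‖ ^ 2 + φ f with hJ
  have hJc : Continuous J := by fun_prop
  have hbdd : BddBelow (Set.range J) :=
    ⟨0, by rintro _ ⟨f, rfl⟩; exact add_nonneg (by positivity) (h0 f)⟩
  set m := ⨅ f, J f with hm
  have hle : ∀ f, m ≤ J f := fun f => ciInf_le hbdd f
  have key : ∀ f g, r / 4 * ‖f - g‖ ^ 2 ≤ (J f + J g) / 2 - m := by
    intro f g
    have h1 := hle ((1 / 2 : ℝ) • (f + g))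
    have h2 := parallelogram_law_with_norm ℝ f g
    have h3 : ‖(1 / 2 : ℝ) • (f + g)‖ ^ 2 = ‖f + g‖ ^ 2 / 4 := by
      rw [norm_smul, mul_pow]; norm_num; ring
    simp only [hJ, h3] at h1 ⊢
    have h4 : ‖f - g‖ ^ 2 = 2 * (‖f‖ ^ 2 + ‖g‖ ^ 2) - ‖f + g‖ ^ 2 := by linarith
    rw [h4]
    linarith [hmid f g]
  have hex : ∀ N : ℕ, ∃ f, J f < m + 1 / (N + 1 : ℝ) := fun N =>
    exists_lt_of_ciInf_lt (lt_add_of_pos_right _ Nat.one_div_pos_of_nat)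
  choose u hu using hex
  have hcau : CauchySeq u := by
    refine cauchySeq_of_le_tendsto_0 (fun N : ℕ => √(4 / r * (1 / (N + 1 : ℝ)))) ?_ ?_
    · intro a b N ha hb
      rw [dist_eq_norm]
      refine Real.le_sqrt_of_sq_le ?_
      have ha' := (hu a).trans_le (add_le_add_right (Nat.one_div_le_one_div (α := ℝ) ha) m)
      have hb' := (hu b).trans_le (add_le_add_right (Nat.one_div_le_one_div (α := ℝ) hb) m)
      have hk := key (u a) (u b)
      have : r / 4 * ‖u a - u b‖ ^ 2 ≤ 1 / (N + 1 : ℝ) := by linarith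
      calc ‖u a - u b‖ ^ 2 = 4 / r * (r / 4 * ‖u a - u b‖ ^ 2) := by field_simp
        _ ≤ _ := by gcongr
    · have := ((tendsto_one_div_add_atTop_nhds_zero_nat (𝕜 := ℝ)).const_mul (4 / r)).sqrt
      simpa using this
  obtain ⟨f, hf⟩ := cauchySeq_tendsto_of_complete hcau
  have hfm : J f ≤ m := by
    have h1 : Tendsto (fun N => J (u N)) atTop (𝓝 (J f)) := (hJc.tendsto f).comp hf
    have h2 : Tendsto (fun N : ℕ => m + 1 / (N + 1 : ℝ)) atTop (𝓝 m) := by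
      simpa using (tendsto_one_div_add_atTop_nhds_zero_nat (𝕜 := ℝ)).const_add m
    exact le_of_tendsto_of_tendsto' h1 h2 fun N => (hu N).le
  refine ⟨f, fun g => hfm.trans (hle g), fun g hg => ?_⟩
  have h1 : J g ≤ J f := hg f
  have h2 := key g f
  have h3 : r / 4 * ‖g - f‖ ^ 2 ≤ 0 := by linarith
  have h4 : ‖g - f‖ ^ 2 ≤ 0 := by
    by_contra! h
    have : 0 < r / 4 * ‖g - f‖ ^ 2 := by positivity
    linarith
  have h5 : ‖g - f‖ = 0 := by
    have := sq_nonneg ‖g - f‖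
    exact pow_eq_zero_iff (two_ne_zero) |>.1 (le_antisymm h4 this)
  exact sub_eq_zero.1 (norm_eq_zero.1 h5)

/-! ### Concentration. -/

/-- A variable with values in `[a, b]` is sub-Gaussian with variance proxy `((b - a) / 2) ^ 2` once
centred. Adding the two tails gives the factor 2 that later appears next to the covering number. -/
theorem hoeffding_two_sided {Z : Type*} [MeasurableSpace Z] (P : Measure Z)
    [IsProbabilityMeasure P] {h : Z → ℝ} (hm : Measurable h) {a b : ℝ} (hab : a < b)
    (hr : ∀ z, h z ∈ Set.Icc a b) {n : ℕ} (hn : 1 ≤ n) {t : ℝ} (ht : 0 ≤ t) :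
    (Measure.pi (fun _ : Fin n => P)).real
        {z | t ≤ |(∫ x, h x ∂P) - (∑ i, h (z i)) / n|}
      ≤ 2 * Real.exp (-(2 * n * t ^ 2 / (b - a) ^ 2)) := by
  set μ := Measure.pi (fun _ : Fin n => P)
  have hn' : (0 : ℝ) < n := by exact_mod_cast hn
  set X : Fin n → (Fin n → Z) → ℝ := fun i z => h (z i) - ∫ x, h x ∂P with hX
  have hmi : ∀ i : Fin n, Measurable fun z : Fin n → Z => h (z i) :=
    fun i => hm.comp (measurable_pi_apply i)
  have hint : ∀ i : Fin n, ∫ z, h (z i) ∂μ = ∫ x, h x ∂P := by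
    intro i
    have e := (measurePreserving_eval (fun _ : Fin n => P) i).map_eq
    conv_rhs => rw [← e]
    rw [integral_map (measurable_pi_apply i).aemeasurable hm.aestronglyMeasurable]
  have hsub : ∀ i, HasSubgaussianMGF (X i) ((‖b - a‖₊ / 2) ^ 2) μ := by
    intro i
    have := hasSubgaussianMGF_of_mem_Icc (μ := μ) (hmi i).aemeasurable
      (ae_of_all _ fun z => hr (z i))
    simpa only [hint i] using this
  have hind : iIndepFun X μ :=
    iIndepFun_pi (X := fun _ x => h x - ∫ x, h x ∂P) fun i => (hm.sub_const _).aemeasurable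
  have hexp : -((n * t) ^ 2) / (2 * ((∑ _i : Fin n, (‖b - a‖₊ / 2) ^ 2 : ℝ≥0) : ℝ))
      = -(2 * n * t ^ 2 / (b - a) ^ 2) := by
    have hba : (b - a) ≠ 0 := by linarith
    simp only [Finset.sum_const, Finset.card_univ, Fintype.card_fin, nsmul_eq_mul]
    push_cast
    rw [div_pow, Real.norm_eq_abs, sq_abs]
    field_simp
  have h1 := HasSubgaussianMGF.measure_sum_ge_le_of_iIndepFun hind (s := Finset.univ)
    (fun i _ => hsub i) (show 0 ≤ n * t by positivity)
  have hind' : iIndepFun (fun i => -X i) μ :=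
    hind.comp (fun _ x => -x) fun _ => measurable_neg
  have h2 := HasSubgaussianMGF.measure_sum_ge_le_of_iIndepFun hind' (s := Finset.univ)
    (fun i _ => (hsub i).neg) (show 0 ≤ n * t by positivity)
  rw [hexp] at h1 h2
  calc _ ≤ μ.real ({z | n * t ≤ ∑ i, X i z} ∪ {z | n * t ≤ ∑ i, (-X i) z}) := by
        refine measureReal_mono ?_
        intro z hz
        have hsum : ∑ i, X i z = (∑ i, h (z i)) - n * ∫ x, h x ∂P := by
          simp [hX, Finset.sum_sub_distrib]
        simp only [Set.mem_union, Set.mem_ofPred_eq, Pi.neg_apply, Finset.sum_neg_distrib, hsum]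
          at hz ⊢
        rcases le_abs.1 hz with h' | h'
        · right
          have := mul_le_mul_of_nonneg_left h' hn'.le
          rw [mul_sub, mul_div_cancel₀ _ hn'.ne'] at this
          linarith
        · left
          have := mul_le_mul_of_nonneg_left h' hn'.le
          rw [mul_neg, mul_sub, mul_div_cancel₀ _ hn'.ne'] at this
          linarith
    _ ≤ _ := (measureReal_union_le _ _).trans (by linarith)

/-! ### Power series approximation and entropy. -/

/-- Functions which are limits of power series with bounded coefficients and geometrically small
remainders have polylogarithmic entropy. -/
theorem exists_isCover_of_geometric_approx {X : Type*} [TopologicalSpace X] [CompactSpace X]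
    {φ : X → ℝ} (hφ : Continuous φ) (hφ1 : ∀ x, |φ x| ≤ 1) {A : Set C(X, ℝ)} {C : ℝ} (hC : 1 ≤ C)
    (hA : ∀ f ∈ A, ∀ δ > 0, ∃ b : ℕ → ℝ, (∀ j, |b j| ≤ C) ∧
      ∀ m : ℕ, ∀ x, |f x - ∑ j ∈ Finset.range m, b j * φ x ^ j| ≤ C * (1 / 2) ^ m + δ)
    {η : ℝ} (hη : 0 < η) (hη1 : η ≤ 1) :
    ∃ T : Finset C(X, ℝ), (∀ f ∈ A, ∃ g ∈ T, ∀ x, |f x - g x| ≤ η) ∧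
      Real.log T.card ≤ 9 * Real.log (4 * C / η) ^ 2 := by
  have hq : 4 ≤ 4 * C / η := by rw [le_div_iff₀ hη]; nlinarith
  set q := 4 * C / η with hqdef
  set y := Real.log q with hy
  have hlog2 : (1 / 2 : ℝ) < Real.log 2 := by linarith [Real.log_two_gt_d9]
  have hy1 : 1 ≤ y := by
    have : Real.log 4 ≤ y := Real.log_le_log (by norm_num) hq
    have h4 : Real.log 4 = 2 * Real.log 2 := by
      rw [show (4 : ℝ) = 2 ^ 2 by norm_num, Real.log_pow]; norm_num
    linarith
  have hyq : y ≤ q := by linarith [Real.log_le_sub_one_of_pos (show 0 < q by linarith)]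
  -- Since `log 2 > 1/2`, this degree gives `2 ^ m ≥ q`, so truncation costs at most `η / 4`.
  set m := ⌈2 * y⌉₊ with hm
  have hm1 : (m : ℝ) ≤ 3 * y := by
    have := Nat.ceil_lt_add_one (show 0 ≤ 2 * y by linarith)
    linarith
  have hm2 : 2 * y ≤ m := Nat.le_ceil _
  have hmpos : (0 : ℝ) < m := by linarith
  have hpow : C * (1 / 2) ^ m ≤ η / 4 := by
    have h1 : q ≤ 2 ^ m := by
      rw [← Real.log_le_log_iff (by linarith) (by positivity), Real.log_pow]
      nlinarith
    rw [one_div, inv_pow, ← div_eq_mul_inv, div_le_iff₀ (by positivity)]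
    calc C = η / 4 * q := by rw [hqdef]; field_simp
      _ ≤ _ := by gcongr
  -- Grid step for the coefficients: rounding costs `w / 2` for each of the `m` terms, `η / 2` in
  -- all. The remaining `η / 4` is spent on `δ`.
  set w := η / m with hw
  have hwpos : 0 < w := by positivity
  -- The extra `1 / 2` leaves room for the rounding of `b j / w`.
  set K := ⌈C / w + 1 / 2⌉₊ with hK
  have hKle : C / w + 1 / 2 ≤ K := Nat.le_ceil _
  have hKlt : (K : ℝ) < C / w + 1 / 2 + 1 := Nat.ceil_lt_add_one (by positivity)
  let G : (Fin m → ℤ) → C(X, ℝ) := fun c =>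
    ⟨fun x => ∑ j : Fin m, (c j * w) * φ x ^ (j : ℕ), by fun_prop⟩
  classical
  refine ⟨(Fintype.piFinset fun _ : Fin m => Finset.Icc (-(K : ℤ)) K).image G, ?_, ?_⟩
  · intro f hf
    obtain ⟨b, hb, happ⟩ := hA f hf (η / 4) (by positivity)
    refine ⟨G fun j => round (b j / w), Finset.mem_image_of_mem _ ?_, ?_⟩
    · rw [Fintype.mem_piFinset]
      intro j
      have h1 := abs_le.1 (abs_sub_round (b j / w))
      have h2 : |b j / w| ≤ C / w := by
        rw [abs_div, abs_of_pos hwpos]; gcongr; exact hb _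
      have h3 := abs_le.1 h2
      rw [Finset.mem_Icc]
      constructor
      · have : -(K : ℝ) ≤ round (b j / w) := by linarith
        exact_mod_cast this
      · have : (round (b j / w) : ℝ) ≤ K := by linarith
        exact_mod_cast this
    · intro x
      have h1 := happ m x
      have h2 : |∑ j ∈ Finset.range m, b j * φ x ^ j -
          ∑ j : Fin m, (round (b j / w) * w) * φ x ^ (j : ℕ)| ≤ η / 2 := by
        rw [Finset.sum_range, ← Finset.sum_sub_distrib]
        calc _ ≤ ∑ j : Fin m, |b j * φ x ^ (j : ℕ) - (round (b j / w) * w) * φ x ^ (j : ℕ)| :=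
              Finset.abs_sum_le_sum_abs _ _
          _ ≤ ∑ j : Fin m, w / 2 := by
              refine Finset.sum_le_sum fun j _ => ?_
              rw [← sub_mul, abs_mul, abs_pow]
              have e : b j - round (b j / w) * w = (b j / w - round (b j / w)) * w := by
                field_simp
              rw [e, abs_mul, abs_of_pos hwpos]
              have := abs_sub_round (b j / w)
              calc _ ≤ (1 / 2 * w) * 1 := by
                    gcongr
                    exact pow_le_one₀ (abs_nonneg _) (hφ1 x)
                _ = w / 2 := by ring
          _ = η / 2 := by
              rw [Finset.sum_const, Finset.card_univ, Fintype.card_fin, nsmul_eq_mul, hw]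
              field_simp
      calc |f x - G (fun j => round (b j / w)) x| ≤ _ := abs_sub_le _ _ _
        _ ≤ (C * (1 / 2) ^ m + η / 4) + η / 2 := add_le_add h1 h2
        _ ≤ η := by linarith
  · rcases Nat.eq_zero_or_pos
      ((Fintype.piFinset fun _ : Fin m => Finset.Icc (-(K : ℤ)) K).image G).card with h0 | h0
    · rw [h0]; simp; positivity
    have hcard : ((Fintype.piFinset fun _ : Fin m => Finset.Icc (-(K : ℤ)) K).image G).card
        ≤ (2 * K + 1) ^ m := by
      refine Finset.card_image_le.trans ?_
      rw [Fintype.card_piFinset]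
      simp only [Int.card_Icc, Finset.prod_const, Finset.card_univ, Fintype.card_fin]
      gcongr
      omega
    -- `C / w = m * q / 4` with `m ≤ 3 * q`, so the number of grid values is of order `q ^ 2`; as `q
    -- ≥ 4`, the cube absorbs the constants.
    have hbase : (2 * K + 1 : ℝ) ≤ q ^ 3 := by
      have e : C / w = m * q / 4 := by rw [hw, hqdef]; field_simp
      have h3 : (m : ℝ) * q ≤ 3 * q * q := by gcongr; linarith
      nlinarith [sq_nonneg q]
    calc _ ≤ Real.log (((2 * K + 1) ^ m : ℕ) : ℝ) :=
          Real.log_le_log (by exact_mod_cast h0) (by exact_mod_cast hcard)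
      _ = m * Real.log (2 * K + 1) := by push_cast; rw [Real.log_pow]
      _ ≤ m * (3 * y) := by
          gcongr
          calc _ ≤ Real.log (q ^ 3) := Real.log_le_log (by positivity) hbase
            _ = 3 * y := by rw [Real.log_pow, hy]; norm_num
      _ ≤ 3 * y * (3 * y) := by gcongr
      _ = _ := by ring

/-- Write `r ^ j = 2⁻ʲ * (2 * r) ^ j`: in the tail `j ≥ m` the first factor is at most `2⁻ᵐ`.
Doubling the argument of the exponential thus buys geometric decay uniformly in `r`. -/
theorem Real.exp_sub_sum_le_half_pow_mul {r : ℝ} (hr : 0 ≤ r) (m : ℕ) :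
    Real.exp r - ∑ j ∈ Finset.range m, r ^ j / j.factorial ≤ (1 / 2) ^ m * Real.exp (2 * r) := by
  have hs : ∀ x : ℝ, HasSum (fun j : ℕ => x ^ j / j.factorial) (Real.exp x) := fun x => by
    rw [Real.exp_eq_exp_ℝ]; exact NormedSpace.expSeries_div_hasSum_exp x
  rw [← (hs r).tsum_eq, ← (hs r).summable.sum_add_tsum_nat_add m, add_sub_cancel_left,
    ← (hs (2 * r)).tsum_eq, ← tsum_mul_left]
  have h2 := (hs (2 * r)).summable.mul_left ((1 / 2 : ℝ) ^ m)
  calc ∑' j : ℕ, r ^ (j + m) / (j + m).factorial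
      ≤ ∑' j : ℕ, (1 / 2) ^ m * ((2 * r) ^ (j + m) / (j + m).factorial) := by
        refine ((summable_nat_add_iff m).2 (hs r).summable).tsum_le_tsum (fun j => ?_)
          ((summable_nat_add_iff m).2 h2)
        rw [← mul_div_assoc]
        gcongr
        have e : (1 / 2 : ℝ) ^ m * (2 * r) ^ (j + m) = 2 ^ j * r ^ (j + m) := by
          rw [mul_pow, pow_add 2 j m, one_div, inv_pow]
          field_simp
        rw [e]
        exact le_mul_of_one_le_left (by positivity) (one_le_pow₀ one_le_two)
    _ ≤ _ := by
        rw [← h2.sum_add_tsum_nat_add m]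
        exact le_add_of_nonneg_left (Finset.sum_nonneg fun j _ => by positivity)

/-- Taylor expansion of a Fourier integral against a density with exponential moments. -/
theorem exists_geometric_approx_fourier {μ : Measure ℝ} {Γ : ℝ → ℂ} (hΓ : Continuous Γ) {R : ℝ}
    (hR : 0 < R) (hint : Integrable (fun ω => ‖Γ ω‖ * Real.exp (3 * R * |ω|)) μ) :
    ∃ b : ℕ → ℝ, (∀ j, |b j| ≤ ∫ ω, ‖Γ ω‖ * Real.exp (3 * R * |ω|) ∂μ) ∧
      ∀ m : ℕ, ∀ θ : ℝ, |θ| ≤ R →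
        |(∫ ω, (Γ ω * Complex.exp (ω * θ * Complex.I)).re ∂μ) -
          ∑ j ∈ Finset.range m, b j * (θ / R) ^ j|
          ≤ (∫ ω, ‖Γ ω‖ * Real.exp (3 * R * |ω|) ∂μ) * (1 / 2) ^ m := by
  -- The Taylor terms at `θ = R`, so that the variable of the power series is `θ / R`, of modulus at
  -- most 1.
  set B : ℕ → ℝ → ℝ := fun j ω => (Γ ω * ((ω * R * Complex.I) ^ j / j.factorial)).re with hB
  have hterm : ∀ j : ℕ, ∀ ω : ℝ, |B j ω| ≤ ‖Γ ω‖ * Real.exp (3 * R * |ω|) := by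
    intro j ω
    refine (Complex.abs_re_le_norm _).trans ?_
    rw [norm_mul]
    gcongr
    simp only [norm_div, norm_pow, norm_mul, Complex.norm_real, Complex.norm_I, mul_one,
      Complex.norm_natCast, Real.norm_eq_abs, abs_of_pos hR]
    refine (Real.pow_div_factorial_le_exp _ (by positivity) j).trans ?_
    refine Real.exp_le_exp.2 ?_
    nlinarith [mul_nonneg (abs_nonneg ω) hR.le]
  have hBi : ∀ j, Integrable (B j) μ := fun j =>
    Integrable.mono' hint
      (Continuous.aestronglyMeasurable (by fun_prop))
      (Eventually.of_forall fun ω => (Real.norm_eq_abs _).trans_le (hterm j ω))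
  have hFi : ∀ θ : ℝ, Integrable (fun ω : ℝ => (Γ ω * Complex.exp (ω * θ * Complex.I)).re) μ := by
    intro θ
    refine Integrable.mono' hint (Continuous.aestronglyMeasurable (by fun_prop))
      (Eventually.of_forall fun ω => ?_)
    refine (Complex.abs_re_le_norm _).trans ?_
    rw [norm_mul, ← Complex.ofReal_mul, Complex.norm_exp_ofReal_mul_I]
    gcongr
    exact Real.one_le_exp (by positivity)
  refine ⟨fun j => ∫ ω, B j ω ∂μ, fun j => ?_, fun m θ hθ => ?_⟩
  · rw [← Real.norm_eq_abs]
    exact norm_integral_le_of_norm_le hint (Eventually.of_forall (hterm j))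
  · have e : (∫ ω, (Γ ω * Complex.exp (ω * θ * Complex.I)).re ∂μ) -
        ∑ j ∈ Finset.range m, (∫ ω, B j ω ∂μ) * (θ / R) ^ j =
        ∫ ω, ((Γ ω * Complex.exp (ω * θ * Complex.I)).re -
          ∑ j ∈ Finset.range m, B j ω * (θ / R) ^ j) ∂μ := by
      rw [integral_sub (hFi θ) (integrable_finsetSum _ fun j _ => (hBi j).mul_const _),
        integral_finsetSum _ fun j _ => (hBi j).mul_const _]
      simp only [integral_mul_const]
    rw [e, ← integral_mul_const, ← Real.norm_eq_abs]
    refine norm_integral_le_of_norm_le (hint.mul_const _) (Eventually.of_forall fun ω => ?_)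
    have e2 : (Γ ω * Complex.exp (ω * θ * Complex.I)).re -
          ∑ j ∈ Finset.range m, B j ω * (θ / R) ^ j =
        (Γ ω * (Complex.exp (ω * θ * Complex.I) -
          ∑ j ∈ Finset.range m, (ω * θ * Complex.I) ^ j / j.factorial)).re := by
      rw [mul_sub, Complex.sub_re, Finset.mul_sum, Complex.re_sum]
      congr 1
      refine Finset.sum_congr rfl fun j _ => ?_
      rw [hB, ← Complex.re_mul_ofReal]
      congr 1
      push_cast
      rw [div_pow, mul_pow, mul_pow, mul_pow, mul_pow]
      have : (R : ℂ) ≠ 0 := by exact_mod_cast hR.ne'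
      field_simp
    rw [e2, Real.norm_eq_abs]
    refine (Complex.abs_re_le_norm _).trans ?_
    rw [norm_mul]
    refine (mul_le_mul_of_nonneg_left ?_ (norm_nonneg _)).trans_eq (mul_assoc _ _ _).symm
    -- The remainder needs the weight `exp (2 * R * |ω|)` and the coefficients only `exp (R * |ω|)`;
    -- the weight `exp (3 * R * |ω|)` dominates both.
    refine (Complex.norm_exp_sub_sum_le_exp_norm_sub_sum _ m).trans
      ((Real.exp_sub_sum_le_half_pow_mul (norm_nonneg _) m).trans ?_)
    rw [mul_comm]
    refine mul_le_mul_of_nonneg_right (Real.exp_le_exp.2 ?_) (by positivity)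
    simp only [norm_mul, Complex.norm_real, Complex.norm_I, mul_one, Real.norm_eq_abs]
    nlinarith [mul_le_mul_of_nonneg_left hθ (abs_nonneg ω), mul_nonneg (abs_nonneg ω) hR.le]

/-! ### Translations on the Fourier side and the size of the diagonal. -/

namespace SymmetricDensity

theorem cosT_eq (p : SymmetricDensity) (θ ω : ℝ) :
    p.cosT θ ω = p.cosT 0 ω * Real.cos (ω * θ) - p.sinT 0 ω * Real.sin (ω * θ) := by
  unfold cosT sinT
  rw [← integral_mul_const, ← integral_mul_const, ← integral_sub
    ((p.integrable_mul (by fun_prop) fun x => Real.abs_cos_le_one _).mul_const _)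
    ((p.integrable_mul (by fun_prop) fun x => Real.abs_sin_le_one _).mul_const _)]
  refine integral_congr_ae (Eventually.of_forall fun x => ?_)
  simp only [add_zero, mul_add, Real.cos_add]
  ring

theorem sinT_eq (p : SymmetricDensity) (θ ω : ℝ) :
    p.sinT θ ω = p.sinT 0 ω * Real.cos (ω * θ) + p.cosT 0 ω * Real.sin (ω * θ) := by
  unfold cosT sinT
  rw [← integral_mul_const, ← integral_mul_const, ← integral_add
    ((p.integrable_mul (by fun_prop) fun x => Real.abs_sin_le_one _).mul_const _)
    ((p.integrable_mul (by fun_prop) fun x => Real.abs_cos_le_one _).mul_const _)]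
  refine integral_congr_ae (Eventually.of_forall fun x => ?_)
  simp only [add_zero, mul_add, Real.sin_add]
  ring

theorem continuous_cosT_right (p : SymmetricDensity) (θ : ℝ) : Continuous (p.cosT θ) :=
  p.continuous_cosT.comp (f := fun ω : ℝ => (θ, ω)) (by fun_prop)

theorem continuous_sinT_right (p : SymmetricDensity) (θ : ℝ) : Continuous (p.sinT θ) :=
  p.continuous_sinT.comp (f := fun ω : ℝ => (θ, ω)) (by fun_prop)

theorem integrable_cosT_mul (p : SymmetricDensity) (θ : ℝ) {μ : Measure ℝ} {g : ℝ → ℝ}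
    (hg : Integrable g μ) : Integrable (fun ω => p.cosT θ ω * g ω) μ :=
  hg.bdd_mul (p.continuous_cosT_right θ).aestronglyMeasurable
    (Eventually.of_forall fun ω => p.abs_cosT_le θ ω)

theorem integrable_sinT_mul (p : SymmetricDensity) (θ : ℝ) {μ : Measure ℝ} {g : ℝ → ℝ}
    (hg : Integrable g μ) : Integrable (fun ω => p.sinT θ ω * g ω) μ :=
  hg.bdd_mul (p.continuous_sinT_right θ).aestronglyMeasurable
    (Eventually.of_forall fun ω => p.abs_sinT_le θ ω)

theorem integrable_cosT (p : SymmetricDensity) (θ : ℝ) {μ : Measure ℝ} [IsFiniteMeasure μ] :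
    Integrable (p.cosT θ) μ := by
  simpa using p.integrable_cosT_mul θ (integrable_const (1 : ℝ) (μ := μ))

theorem integrable_sinT (p : SymmetricDensity) (θ : ℝ) {μ : Measure ℝ} [IsFiniteMeasure μ] :
    Integrable (p.sinT θ) μ := by
  simpa using p.integrable_sinT_mul θ (integrable_const (1 : ℝ) (μ := μ))

/-- If the mean of `h` were 1, the nonnegative function `p * (1 - h)` would vanish almost
everywhere, hence so would `p`, contradicting total mass 1. -/
theorem integral_mul_lt_one (p : SymmetricDensity) {h : ℝ → ℝ} (hm : Measurable h)
    (h0 : ∀ x, 0 ≤ h x) (h1 : ∀ x, h x ≤ 1) (hlt : ∀ᵐ x, h x < 1) :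
    ∫ x, p.toFun x * h x < 1 := by
  have hi : Integrable (fun x => p.toFun x * h x) := p.integrable.mul_bdd (c := 1)
    hm.aestronglyMeasurable (Eventually.of_forall fun x => by
      rw [Real.norm_of_nonneg (h0 x)]; exact h1 x)
  have hd : Integrable (fun x => p.toFun x * (1 - h x)) := by
    simp only [mul_sub, mul_one]
    exact p.integrable.sub hi
  have hnn : 0 ≤ fun x => p.toFun x * (1 - h x) := fun x =>
    mul_nonneg (p.nonneg x) (by linarith [h1 x])
  have hpos : 0 < ∫ x, p.toFun x * (1 - h x) := by
    refine lt_of_le_of_ne (integral_nonneg hnn) fun h => ?_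
    have hz := (integral_eq_zero_iff_of_nonneg hnn hd).1 h.symm
    have hp : p.toFun =ᵐ[volume] 0 := by
      filter_upwards [hz, hlt] with x hx hl
      rcases mul_eq_zero.1 hx with h' | h'
      · exact h'
      · linarith
    have := integral_congr_ae hp
    rw [p.integral_eq_one] at this
    simp at this
  have e : ∫ x, p.toFun x * (1 - h x) = 1 - ∫ x, p.toFun x * h x := by
    simp only [mul_sub, mul_one]
    rw [integral_sub p.integrable hi, p.integral_eq_one]
  linarith

end SymmetricDensity

/-- A translation rotates the pair `(cosT, sinT)` by the angle `ω * θ` and preserves the sum of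
squares. -/
theorem locKernel_self (p : SymmetricDensity) (s : ℝ≥0) (σ θ : ℝ) :
    locKernel p s σ θ θ = locKernel p s σ 0 0 := by
  rw [locKernel_eq, locKernel_eq]
  congr 2
  ext ω
  rw [p.cosT_eq θ, p.sinT_eq θ]
  linear_combination (p.cosT 0 ω ^ 2 + p.sinT 0 ω ^ 2) * Real.sin_sq_add_cos_sq (ω * θ)

theorem locKernel_self_nonneg (p : SymmetricDensity) (s : ℝ≥0) (σ θ : ℝ) :
    0 ≤ locKernel p s σ θ θ := by
  rw [locKernel_eq]
  exact mul_nonneg s.2 (integral_nonneg fun ω => by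
    exact add_nonneg (mul_self_nonneg _) (mul_self_nonneg _))

/-- The Gaussian is below 1 off the diagonal, and each slice of the diagonal is a null set. The
inequality remains strict through both integrations by `integral_mul_lt_one`, so `s = 1` is allowed.
-/
theorem locKernel_zero_lt_one (p : SymmetricDensity) {s : ℝ≥0} {σ : ℝ} (hσ : 0 < σ)
    (hs : s ≤ 1) : locKernel p s σ 0 0 < 1 := by
  set e : ℝ → ℝ → ℝ := fun x x' => Real.exp (-(x - x') ^ 2 / (2 * σ ^ 2)) with he
  have hem : Measurable (Function.uncurry e) := by
    apply Continuous.measurable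
    simp only [he, Function.uncurry_def]
    fun_prop
  have he1 : ∀ x x', e x x' ≤ 1 := fun x x' => by
    refine Real.exp_le_one_iff.2 ?_
    rw [neg_div]
    exact neg_nonpos.2 (by positivity)
  have helt : ∀ x x', x' ≠ x → e x x' < 1 := fun x x' h => by
    rw [← Real.exp_zero]
    refine Real.exp_lt_exp.2 ?_
    have : 0 < (x - x') ^ 2 := by
      have := sub_ne_zero.2 h.symm
      positivity
    rw [neg_div]
    exact neg_neg_of_pos (by positivity)
  have h1 : ∀ x, ∫ x', p.toFun x' * e x x' < 1 := fun x =>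
    p.integral_mul_lt_one (hem.comp measurable_prodMk_left) (fun _ => (Real.exp_pos _).le)
      (he1 x) (by
        filter_upwards [compl_mem_ae_iff.2 (measure_singleton x)] with x' hx'
        exact helt x x' hx')
  have hm : Measurable fun x => ∫ x', p.toFun x' * e x x' := by
    have : StronglyMeasurable (Function.uncurry fun x x' => p.toFun x' * e x x') :=
      ((p.measurable.comp measurable_snd).mul hem).stronglyMeasurable
    exact this.integral_prod_right.measurable
  have h2 := p.integral_mul_lt_one hm
    (fun x => integral_nonneg fun x' => mul_nonneg (p.nonneg _) (Real.exp_pos _).le)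
    (fun x => (h1 x).le) (Eventually.of_forall h1)
  have e1 : locKernel p s σ 0 0 = s * ∫ x, p.toFun x * ∫ x', p.toFun x' * e x x' := by
    unfold locKernel gmmk gaussianRBF SymmetricDensity.shift
    rw [← integral_const_mul]
    congr 1; ext x
    rw [← integral_const_mul, ← integral_const_mul]
    congr 1; ext y
    simp only [sub_zero, he]
    ring
  have h0 : 0 ≤ ∫ x, p.toFun x * ∫ x', p.toFun x' * e x x' :=
    integral_nonneg fun x => mul_nonneg (p.nonneg _)
      (integral_nonneg fun x' => mul_nonneg (p.nonneg _) (Real.exp_pos _).le)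
  rw [e1]
  have hs' : (s : ℝ) ≤ 1 := by exact_mod_cast hs
  nlinarith [s.2]

/-! ### Kernel combinations and their spectral representation. -/

namespace GmmkRKHS

variable {p : SymmetricDensity} {s : ℝ≥0} {σ : ℝ} {Θ : Set ℝ}

theorem abs_apply_le (f : GmmkRKHS p s σ Θ) (θ : Θ) :
    |f θ| ≤ √(locKernel p s σ 0 0) * ‖f‖ := by
  have h := RKHS.norm_apply_le f θ
  rw [RKHS.OfKernel.kernel_ofKernel] at h
  have hn : ‖gmmkMatrix p s σ Θ θ θ‖ = locKernel p s σ 0 0 := by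
    simp only [gmmkMatrix, Matrix.of_apply, norm_smul, ContinuousLinearMap.norm_id, mul_one]
    rw [Real.norm_of_nonneg (locKernel_self_nonneg p s σ θ), locKernel_self]
  rwa [hn, mul_comm] at h

theorem abs_apply_le_norm (hk : locKernel p s σ 0 0 ≤ 1) (f : GmmkRKHS p s σ Θ) (θ : Θ) :
    |f θ| ≤ ‖f‖ :=
  (abs_apply_le f θ).trans (mul_le_of_le_one_left (norm_nonneg _) (Real.sqrt_le_one.2 hk))

theorem inner_kerSec (θ : Θ) (f : GmmkRKHS p s σ Θ) :
    ⟪RKHS.kerFun (GmmkRKHS p s σ Θ) θ (1 : ℝ), f⟫ = f θ := by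
  rw [RKHS.kerFun_inner]
  simp

theorem inner_kerSec_kerSec (θ θ' : Θ) :
    ⟪RKHS.kerFun (GmmkRKHS p s σ Θ) θ (1 : ℝ), RKHS.kerFun (GmmkRKHS p s σ Θ) θ' (1 : ℝ)⟫ =
      locKernel p s σ θ θ' := by
  rw [inner_kerSec, RKHS.kerFun_apply, RKHS.OfKernel.kernel_ofKernel]
  simp [gmmkMatrix]

/-- The linear combination of kernel sections with the given coefficients. -/
noncomputable def kerComb (p : SymmetricDensity) (s : ℝ≥0) (σ : ℝ) (c : Θ →₀ ℝ) : GmmkRKHS p s σ Θ :=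
  c.sum fun x a => a • RKHS.kerFun (GmmkRKHS p s σ Θ) x (1 : ℝ)

theorem exists_kerComb_near (f : GmmkRKHS p s σ Θ) {δ : ℝ} (hδ : 0 < δ) :
    ∃ c, ‖f - kerComb p s σ c‖ < δ := by
  have hd := RKHS.kerFun_dense (GmmkRKHS p s σ Θ)
  have hf : f ∈ (Submodule.span ℝ
      {RKHS.kerFun (GmmkRKHS p s σ Θ) x v | (x) (v)}).topologicalClosure := by
    rw [hd]; trivial
  obtain ⟨g, hg, hfg⟩ := Metric.mem_closure_iff.1 hf δ hδ
  have hle : Submodule.span ℝ {RKHS.kerFun (GmmkRKHS p s σ Θ) x v | (x) (v)} ≤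
      Submodule.span ℝ (Set.range fun x : Θ => RKHS.kerFun (GmmkRKHS p s σ Θ) x (1 : ℝ)) := by
    refine Submodule.span_le.2 ?_
    rintro _ ⟨x, v, rfl⟩
    have : RKHS.kerFun (GmmkRKHS p s σ Θ) x v = v • RKHS.kerFun (GmmkRKHS p s σ Θ) x (1 : ℝ) := by
      rw [← map_smul, smul_eq_mul, mul_one]
    rw [this]
    exact Submodule.smul_mem _ _ (Submodule.subset_span ⟨x, rfl⟩)
  obtain ⟨c, hc⟩ := (Finsupp.mem_span_range_iff_exists_finsupp).1 (hle hg)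
  refine ⟨c, ?_⟩
  rw [← dist_eq_norm, kerComb, hc]
  exact hfg

theorem integrable_sum_cosT (c : Θ →₀ ℝ) :
    Integrable (fun ω => c.sum fun x a => a * p.cosT x ω) (specMeasure σ) :=
  integrable_finsetSum _ fun x _ => (p.integrable_cosT x).const_mul _

theorem integrable_sum_sinT (c : Θ →₀ ℝ) :
    Integrable (fun ω => c.sum fun x a => a * p.sinT x ω) (specMeasure σ) :=
  integrable_finsetSum _ fun x _ => (p.integrable_sinT x).const_mul _

theorem kerComb_apply (c : Θ →₀ ℝ) (θ : Θ) :
    kerComb p s σ c θ = s * ∫ ω, (p.cosT θ ω * (c.sum fun x a => a * p.cosT x ω) +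
      p.sinT θ ω * (c.sum fun x a => a * p.sinT x ω)) ∂(specMeasure σ) := by
  have h1 : kerComb p s σ c θ = c.sum fun x a => a * locKernel p s σ θ x := by
    rw [← inner_kerSec, kerComb, Finsupp.inner_sum]
    refine Finset.sum_congr rfl fun x _ => ?_
    simp only [inner_smul_right, inner_kerSec_kerSec]
  rw [h1]
  simp only [locKernel_eq]
  rw [Finsupp.sum, ← integral_const_mul]
  simp only [← integral_const_mul]
  rw [← integral_finsetSum]
  · refine integral_congr_ae (Eventually.of_forall fun ω => ?_)
    simp only [Finsupp.sum, Finset.mul_sum, ← Finset.sum_add_distrib]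
    refine Finset.sum_congr rfl fun x _ => ?_
    ring
  · intro x _
    exact (((p.integrable_cosT_mul θ (p.integrable_cosT x)).add
      (p.integrable_sinT_mul θ (p.integrable_sinT x))).const_mul _).const_mul _

/-- This isometry turns a bound on the RKHS norm into an `L²` bound on the spectral amplitudes,
independent of the number and position of the nodes. -/
theorem norm_kerComb_sq (c : Θ →₀ ℝ) :
    ‖kerComb p s σ c‖ ^ 2 = s * ∫ ω, ((c.sum fun x a => a * p.cosT x ω) ^ 2 +
      (c.sum fun x a => a * p.sinT x ω) ^ 2) ∂(specMeasure σ) := by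
  have h1 : ‖kerComb p s σ c‖ ^ 2 = c.sum fun x a => a * kerComb p s σ c x := by
    rw [← real_inner_self_eq_norm_sq]
    conv_lhs => enter [2]; rw [kerComb]
    rw [Finsupp.sum_inner]
    refine Finset.sum_congr rfl fun x _ => ?_
    simp only [inner_smul_left, inner_kerSec, conj_trivial]
  rw [h1]
  simp only [kerComb_apply]
  rw [Finsupp.sum, ← integral_const_mul]
  simp only [← integral_const_mul]
  rw [← integral_finsetSum]
  · refine integral_congr_ae (Eventually.of_forall fun ω => ?_)
    simp only [sq]
    conv_rhs => enter [2, 1, 1]; rw [Finsupp.sum]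
    conv_rhs => enter [2, 2, 1]; rw [Finsupp.sum]
    rw [Finset.sum_mul, Finset.sum_mul, ← Finset.sum_add_distrib, Finset.mul_sum]
    refine Finset.sum_congr rfl fun x _ => ?_
    ring
  · intro x _
    exact (((p.integrable_cosT_mul x (integrable_sum_cosT c)).add
      (p.integrable_sinT_mul x (integrable_sum_sinT c))).const_mul _).const_mul _

end GmmkRKHS

/-! ### Entropy of the unit ball. -/

theorem integrable_exp_abs_specMeasure (σ a : ℝ) :
    Integrable (fun ω => Real.exp (a * |ω|)) (specMeasure σ) :=
  integrable_exp_mul_abs (integrable_exp_mul_gaussianReal a) (integrable_exp_mul_gaussianReal (-a))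

namespace GmmkRKHS

variable {p : SymmetricDensity} {s : ℝ≥0} {σ : ℝ} {Θ : Set ℝ}

/-- The amplitude is controlled only in `L²`, while the Taylor expansion needs it integrable against
`exp (3 * R * |ω|)`. The inequality `2 * A * E ≤ A ^ 2 + E ^ 2` separates the two: the first square
integrates, with the factor `s`, to the squared norm, at most 4, and the second is an exponential
moment of the Gaussian. -/
theorem exists_geometric_approx_kerComb (p : SymmetricDensity) (s : ℝ≥0) (σ : ℝ) {R : ℝ}
    (hR : 0 < R) (hΘ : ∀ θ ∈ Θ, |θ| ≤ R) (c : Θ →₀ ℝ) (hc : ‖kerComb p s σ c‖ ≤ 2) :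
    ∃ b : ℕ → ℝ, (∀ j, |b j| ≤ 4 + s * ∫ ω, Real.exp (6 * R * |ω|) ∂(specMeasure σ)) ∧
      ∀ (m : ℕ) (θ : Θ), |kerComb p s σ c θ - ∑ j ∈ Finset.range m, b j * (θ / R) ^ j|
        ≤ (4 + s * ∫ ω, Real.exp (6 * R * |ω|) ∂(specMeasure σ)) * (1 / 2) ^ m := by
  set g : ℝ → ℝ := fun ω => c.sum fun x a => a * p.cosT x ω with hg
  set h : ℝ → ℝ := fun ω => c.sum fun x a => a * p.sinT x ω with hh
  have hgc : Continuous g := continuous_finsetSum _ fun x _ =>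
    continuous_const.mul (p.continuous_cosT_right x)
  have hhc : Continuous h := continuous_finsetSum _ fun x _ =>
    continuous_const.mul (p.continuous_sinT_right x)
  -- Translation multiplies `cosT 0 + i sinT 0` by `exp (i ω θ)`, so the real part of `Γ ω * exp (i
  -- ω θ)` is the integrand `s * (cosT θ * g + sinT θ * h)` of `kerComb_apply`.
  set Γ : ℝ → ℂ := fun ω => s * ((g ω - h ω * Complex.I) *
    (p.cosT 0 ω + p.sinT 0 ω * Complex.I)) with hΓ
  have hΓc : Continuous Γ := by
    have := p.continuous_cosT_right 0
    have := p.continuous_sinT_right 0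
    fun_prop
  have hgg : Integrable (fun ω => g ω ^ 2 + h ω ^ 2) (specMeasure σ) := by
    refine Integrable.add ?_ ?_
    · have : Integrable (fun ω => c.sum fun x a => a * (p.cosT x ω * g ω)) (specMeasure σ) :=
        integrable_finsetSum _ fun x _ =>
          (p.integrable_cosT_mul x (integrable_sum_cosT c)).const_mul _
      refine this.congr (Eventually.of_forall fun ω => ?_)
      simp only [hg, Finsupp.sum, sq, Finset.sum_mul]
      exact Finset.sum_congr rfl fun x _ => by ring
    · have : Integrable (fun ω => c.sum fun x a => a * (p.sinT x ω * h ω)) (specMeasure σ) :=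
        integrable_finsetSum _ fun x _ =>
          (p.integrable_sinT_mul x (integrable_sum_sinT c)).const_mul _
      refine this.congr (Eventually.of_forall fun ω => ?_)
      simp only [hh, Finsupp.sum, sq, Finset.sum_mul]
      exact Finset.sum_congr rfl fun x _ => by ring
  have hE := integrable_exp_abs_specMeasure σ (6 * R)
  have hdom : Integrable (fun ω => s * (g ω ^ 2 + h ω ^ 2) + s * Real.exp (6 * R * |ω|))
      (specMeasure σ) := (hgg.const_mul _).add (hE.const_mul _)
  have hle : ∀ ω, ‖Γ ω‖ * Real.exp (3 * R * |ω|) ≤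
      s * (g ω ^ 2 + h ω ^ 2) + s * Real.exp (6 * R * |ω|) := by
    intro ω
    have h1 : ‖(p.cosT 0 ω + p.sinT 0 ω * Complex.I : ℂ)‖ ≤ 2 := by
      refine (norm_add_le _ _).trans ?_
      rw [norm_mul, Complex.norm_I, mul_one, Complex.norm_real, Complex.norm_real]
      have := p.abs_cosT_le 0 ω
      have := p.abs_sinT_le 0 ω
      simp only [Real.norm_eq_abs]
      linarith
    have h2 : ‖(g ω - h ω * Complex.I : ℂ)‖ ^ 2 = g ω ^ 2 + h ω ^ 2 := by
      rw [← Complex.normSq_eq_norm_sq, Complex.normSq_apply]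
      simp
      ring
    have h3 : Real.exp (6 * R * |ω|) = Real.exp (3 * R * |ω|) ^ 2 := by
      rw [← Real.exp_nat_mul]; congr 1; push_cast; ring
    have h4 : ‖(s : ℂ)‖ = s := by
      simp
    rw [hΓ]
    simp only [norm_mul, h4]
    rw [← h2, h3, ← mul_add, mul_assoc, mul_assoc]
    refine mul_le_mul_of_nonneg_left ?_ s.2
    set A := ‖(g ω - h ω * Complex.I : ℂ)‖
    set E := Real.exp (3 * R * |ω|)
    have hA : 0 ≤ A := norm_nonneg _
    have hEp : 0 < E := Real.exp_pos _
    calc _ ≤ A * (2 * E) := by gcongr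
      _ ≤ A ^ 2 + E ^ 2 := by nlinarith [sq_nonneg (A - E)]
  have hint : Integrable (fun ω => ‖Γ ω‖ * Real.exp (3 * R * |ω|)) (specMeasure σ) := by
    refine hdom.mono' (Continuous.aestronglyMeasurable (by fun_prop))
      (Eventually.of_forall fun ω => ?_)
    rw [Real.norm_of_nonneg (by positivity)]
    exact hle ω
  have hbound : ∫ ω, ‖Γ ω‖ * Real.exp (3 * R * |ω|) ∂(specMeasure σ) ≤
      4 + s * ∫ ω, Real.exp (6 * R * |ω|) ∂(specMeasure σ) := by
    refine (integral_mono hint hdom hle).trans ?_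
    rw [integral_add (hgg.const_mul _) (hE.const_mul _), integral_const_mul, integral_const_mul,
      ← norm_kerComb_sq]
    nlinarith [norm_nonneg (kerComb p s σ c)]
  obtain ⟨b, hb1, hb2⟩ := exists_geometric_approx_fourier hΓc hR hint
  refine ⟨b, fun j => (hb1 j).trans hbound, fun m θ => ?_⟩
  have happ : kerComb p s σ c θ =
      ∫ ω, (Γ ω * Complex.exp (ω * (θ : ℝ) * Complex.I)).re ∂(specMeasure σ) := by
    rw [kerComb_apply, ← integral_const_mul]
    refine integral_congr_ae (Eventually.of_forall fun ω => ?_)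
    have e1 : Γ ω * Complex.exp (ω * (θ : ℝ) * Complex.I) = ((s : ℝ) : ℂ) *
        ((g ω - h ω * Complex.I) * (p.cosT θ ω + p.sinT θ ω * Complex.I)) := by
      rw [p.cosT_eq θ, p.sinT_eq θ, ← Complex.ofReal_mul, Complex.exp_mul_I, ← Complex.ofReal_cos,
        ← Complex.ofReal_sin, hΓ]
      push_cast
      linear_combination (s : ℂ) * (g ω - h ω * Complex.I) * p.sinT 0 ω *
        Complex.sin (ω * θ) * Complex.I_sq
    simp only [e1, Complex.re_ofReal_mul]
    simp
    ring_nf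
    exact Or.inl rfl
  rw [happ]
  refine (hb2 m θ (hΘ θ θ.2)).trans ?_
  gcongr

/-- Explicit amplitudes are at hand only for kernel combinations, which are dense. Since the sup
norm is at most the RKHS norm, passing to a nearby combination costs `δ`; keeping it within distance
1 of `f` gives the norm bound 2. -/
theorem exists_geometric_approx (p : SymmetricDensity) (s : ℝ≥0) (σ : ℝ)
    (hk : locKernel p s σ 0 0 ≤ 1) {R : ℝ}
    (hR : 0 < R) (hΘ : ∀ θ ∈ Θ, |θ| ≤ R) (f : GmmkRKHS p s σ Θ) (hf : ‖f‖ ≤ 1) {δ : ℝ}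
    (hδ : 0 < δ) :
    ∃ b : ℕ → ℝ, (∀ j, |b j| ≤ 4 + s * ∫ ω, Real.exp (6 * R * |ω|) ∂(specMeasure σ)) ∧
      ∀ (m : ℕ) (θ : Θ), |f θ - ∑ j ∈ Finset.range m, b j * (θ / R) ^ j|
        ≤ (4 + s * ∫ ω, Real.exp (6 * R * |ω|) ∂(specMeasure σ)) * (1 / 2) ^ m + δ := by
  obtain ⟨c, hc⟩ := exists_kerComb_near f (lt_min hδ one_pos)
  have h2 : ‖kerComb p s σ c‖ ≤ 2 := by
    have := norm_sub_norm_le (kerComb p s σ c) f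
    rw [norm_sub_rev] at this
    linarith [hc.trans_le (min_le_right _ _)]
  obtain ⟨b, hb1, hb2⟩ := exists_geometric_approx_kerComb p s σ hR hΘ c h2
  refine ⟨b, hb1, fun m θ => ?_⟩
  have h3 : |f θ - kerComb p s σ c θ| ≤ δ := by
    have := abs_apply_le_norm hk (f - kerComb p s σ c) θ
    rw [RKHS.coe_sub, Pi.sub_apply] at this
    exact this.trans (hc.le.trans (min_le_left _ _))
  calc _ ≤ _ := abs_sub_le _ (kerComb p s σ c θ) _
    _ ≤ _ := by linarith [hb2 m θ]

theorem isCover_of_forall_abs_sub_le [CompactSpace Θ] {A : Set C(Θ, ℝ)} {T : Set C(Θ, ℝ)} {η : ℝ}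
    (hη : 0 ≤ η) (h : ∀ f ∈ A, ∃ g ∈ T, ∀ x, |f x - g x| ≤ η) :
    Metric.IsCover η.toNNReal A T := by
  intro f hf
  obtain ⟨g, hg, hfg⟩ := h f hf
  refine ⟨g, hg, ?_⟩
  change edist f g ≤ ENNReal.ofReal η
  rw [edist_dist]
  refine ENNReal.ofReal_le_ofReal ((ContinuousMap.dist_le hη).2 fun x => ?_)
  rw [Real.dist_eq]
  exact hfg x

theorem ballCoveringNumber_le_card [CompactSpace Θ] {T : Finset C(Θ, ℝ)} {η : ℝ} (hη : 0 ≤ η)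
    (h : ∀ f : GmmkRKHS p s σ Θ, ‖f‖ ≤ 1 → ∃ g ∈ T, ∀ x, |f x - g x| ≤ η) :
    ballCoveringNumber p s σ Θ η ≤ T.card := by
  rw [← Set.encard_coe_eq_coe_finsetCard]
  refine (isCover_of_forall_abs_sub_le hη ?_).externalCoveringNumber_le_encard
  rintro _ ⟨f, hf, rfl⟩
  exact h f (by simpa using hf)

theorem ballCoveringNumber_pos [CompactSpace Θ] (η : ℝ) : 0 < ballCoveringNumber p s σ Θ η :=
  Metric.externalCoveringNumber_pos_iff.2
    ⟨_, 0, Metric.mem_closedBall_self zero_le_one, rfl⟩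

theorem log_ballCoveringNumber_le [CompactSpace Θ] {T : Finset C(Θ, ℝ)} {η : ℝ} (hη : 0 ≤ η)
    (h : ∀ f : GmmkRKHS p s σ Θ, ‖f‖ ≤ 1 → ∃ g ∈ T, ∀ x, |f x - g x| ≤ η) :
    ballCoveringNumber p s σ Θ η ≠ ⊤ ∧
      Real.log (ballCoveringNumber p s σ Θ η).toNat ≤ Real.log T.card := by
  have hle := ballCoveringNumber_le_card hη h
  have htop := ne_top_of_le_ne_top (ENat.natCast_ne_top _) hle
  refine ⟨htop, Real.log_le_log ?_ ?_⟩
  · have := ballCoveringNumber_pos (p := p) (s := s) (σ := σ) (Θ := Θ) η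
    have : (ballCoveringNumber p s σ Θ η).toNat ≠ 0 := by
      rw [Ne, ENat.toNat_eq_zero]
      exact not_or.2 ⟨this.ne', htop⟩
    exact_mod_cast Nat.pos_of_ne_zero this
  · exact_mod_cast ENat.toNat_le_of_le_natCast hle

/-- The entropy of the unit ball grows at most like the square of the logarithm. -/
theorem exists_log_ballCoveringNumber_le (p : SymmetricDensity) (s : ℝ≥0) (σ : ℝ)
    (hk : locKernel p s σ 0 0 < 1) (Θ : Set ℝ) [CompactSpace Θ] :
    ∃ c : ℝ, 0 < c ∧ ∀ η : ℝ, 0 < η → ballCoveringNumber p s σ Θ η ≠ ⊤ ∧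
      Real.log (ballCoveringNumber p s σ Θ η).toNat ≤ c * Real.log (1 / η) ^ 2 := by
  obtain ⟨R, hR, hΘ⟩ : ∃ R > 0, ∀ θ ∈ Θ, |θ| ≤ R := by
    obtain ⟨R, hR⟩ := (isCompact_iff_compactSpace.2 ‹_› : IsCompact Θ).isBounded.exists_norm_le
    exact ⟨max R 1, by positivity, fun θ hθ => (hR θ hθ).trans (le_max_left _ _)⟩
  set C := 4 + s * ∫ ω, Real.exp (6 * R * |ω|) ∂(specMeasure σ) with hC
  have hC1 : 1 ≤ C := by
    have : 0 ≤ ∫ ω, Real.exp (6 * R * |ω|) ∂(specMeasure σ) :=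
      integral_nonneg fun ω => (Real.exp_pos _).le
    have := mul_nonneg s.coe_nonneg this
    rw [hC]
    linarith
  -- Threshold between the two regimes. The maximum with `1 / 2` keeps `k` positive when the kernel
  -- vanishes.
  set k := max √(locKernel p s σ 0 0) (1 / 2) with hkdef
  have hk0 : 0 < k := lt_max_of_lt_right one_half_pos
  have hk1 : k < 1 := max_lt ((Real.sqrt_lt' one_pos).2 (by simpa using hk)) one_half_lt_one
  set L := Real.log (1 / k) with hL
  have hLpos : 0 < L := Real.log_pos ((one_lt_div hk0).2 hk1)
  have hlogC : 0 ≤ Real.log (4 * C) := Real.log_nonneg (by linarith)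
  -- For `η < k` one has `log (1/η) ≥ L`, hence `log (4 * C) ≤ (log (4 * C) / L) * log (1/η)`; the 9
  -- comes from the rounding count.
  refine ⟨9 * (Real.log (4 * C) / L + 1) ^ 2, by positivity, fun η hη => ?_⟩
  rcases le_or_gt k η with hkη | hkη
  · have := log_ballCoveringNumber_le (p := p) (s := s) (σ := σ) (Θ := Θ) (T := {0}) hη.le
      fun f hf => ⟨0, Finset.mem_singleton_self _, fun x => by
        rw [ContinuousMap.zero_apply, sub_zero]
        refine (abs_apply_le f x).trans ((mul_le_of_le_one_right (Real.sqrt_nonneg _) hf).trans ?_)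
        exact (le_max_left _ _).trans hkη⟩
    refine ⟨this.1, this.2.trans ?_⟩
    simp only [Finset.card_singleton, Nat.cast_one, Real.log_one]
    positivity
  · obtain ⟨T, hT, hcard⟩ := exists_isCover_of_geometric_approx (X := Θ)
      (φ := fun θ => (θ : ℝ) / R) (by fun_prop)
      (fun θ => by
        rw [abs_div, abs_of_pos hR, div_le_one hR]
        exact hΘ θ θ.2)
      (A := inclusion '' Metric.closedBall (0 : GmmkRKHS p s σ Θ) 1) hC1
      (by
        rintro _ ⟨f, hf, rfl⟩ δ hδ
        exact exists_geometric_approx p s σ hk.le hR hΘ f (by simpa using hf) hδ)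
      hη (hkη.trans hk1).le
    have := log_ballCoveringNumber_le (p := p) (s := s) (σ := σ) (Θ := Θ) hη.le
      fun f hf => hT _ ⟨f, by simpa using hf, rfl⟩
    refine ⟨this.1, this.2.trans (hcard.trans ?_)⟩
    have hLη : L ≤ Real.log (1 / η) := Real.log_le_log (by positivity) (by gcongr)
    have hy : Real.log (4 * C / η) ≤ (Real.log (4 * C) / L + 1) * Real.log (1 / η) := by
      rw [div_eq_mul_one_div, Real.log_mul (by positivity) (by positivity), add_mul, one_mul]
      gcongr
      rw [div_mul_eq_mul_div, le_div_iff₀ hLpos]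
      gcongr
    have hy0 : 0 ≤ Real.log (4 * C / η) := Real.log_nonneg (by
      rw [le_div_iff₀ hη]; linarith)
    calc _ ≤ 9 * ((Real.log (4 * C) / L + 1) * Real.log (1 / η)) ^ 2 := by gcongr
      _ = _ := by ring

end GmmkRKHS

/-! ### The hinge loss, risks and SVM solutions. -/

theorem hinge_nonneg (y t : ℝ) : 0 ≤ hinge y t := le_max_left _ _

theorem Label.abs_eq_one (y : Label) : |(y : ℝ)| = 1 := by
  obtain ⟨y, rfl | rfl⟩ := y <;> simp

theorem abs_hinge_sub_hinge_le (y : Label) (t u : ℝ) : |hinge y t - hinge y u| ≤ |t - u| := by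
  unfold hinge
  rw [max_comm, max_comm 0]
  refine (abs_max_sub_max_le_abs _ _ _).trans ?_
  rw [show 1 - (y : ℝ) * t - (1 - y * u) = y * (u - t) by ring, abs_mul, Label.abs_eq_one y, one_mul,
    abs_sub_comm]

theorem hinge_le (y : Label) {t M : ℝ} (ht : |t| ≤ M) : hinge y t ≤ 1 + M := by
  refine max_le (by linarith [abs_nonneg t]) ?_
  have : |(y : ℝ) * t| ≤ M := by rwa [abs_mul, Label.abs_eq_one y, one_mul]
  linarith [(abs_le.1 this).1]

theorem hinge_midpoint_le (y t u : ℝ) :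
    hinge y (1 / 2 * (t + u)) ≤ (hinge y t + hinge y u) / 2 := by
  unfold hinge
  refine max_le (by positivity) ?_
  linarith [le_max_right 0 (1 - y * t), le_max_right 0 (1 - y * u)]

section

variable {Θ : Set ℝ}

theorem measurable_hinge_comp {g : Θ → ℝ} (hg : Continuous g) :
    Measurable fun z : Θ × Label => hinge z.2 (g z.1) := by
  unfold hinge
  have := hg.measurable
  fun_prop

theorem integrable_hinge_comp (Q : Measure (Θ × Label)) [IsFiniteMeasure Q] {g : Θ → ℝ}
    (hg : Continuous g) {M : ℝ} (hM : ∀ x, |g x| ≤ M) :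
    Integrable (fun z : Θ × Label => hinge z.2 (g z.1)) Q :=
  (integrable_const (1 + M)).mono' (measurable_hinge_comp hg).aestronglyMeasurable
    (Eventually.of_forall fun z => by
      rw [Real.norm_of_nonneg (hinge_nonneg _ _)]; exact hinge_le z.2 (hM z.1))

theorem integral_empirical {n : ℕ} (z : Fin n → Θ × Label) (h : Θ × Label → ℝ) :
    ∫ x, h x ∂(empirical z) = (∑ i, h (z i)) / n := by
  unfold empirical
  rw [integral_smul_measure, integral_finsetSum_measure fun i _ => integrable_dirac (by simp)]
  simp only [integral_dirac, smul_eq_mul]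
  rw [ENNReal.toReal_inv, ENNReal.toReal_natCast, inv_mul_eq_div]

theorem isProbabilityMeasure_empirical {n : ℕ} (hn : 1 ≤ n) (z : Fin n → Θ × Label) :
    IsProbabilityMeasure (empirical z) := by
  constructor
  have : (n : ℝ≥0∞) ≠ 0 := by exact_mod_cast Nat.one_le_iff_ne_zero.1 hn
  simp [empirical, ENNReal.inv_mul_cancel this]

/-- Replacing a loss by that of a net point changes the true and the empirical mean by `ε` each. -/
theorem abs_integral_sub_sum_le (P : Measure (Θ × Label)) [IsProbabilityMeasure P] {n : ℕ}
    (hn : 1 ≤ n) (z : Fin n → Θ × Label) {h h' : Θ × Label → ℝ} (hi : Integrable h P)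
    (hi' : Integrable h' P) {ε : ℝ} (hε : ∀ x, |h x - h' x| ≤ ε) :
    |(∫ x, h x ∂P) - (∑ i, h (z i)) / n| ≤
      |(∫ x, h' x ∂P) - (∑ i, h' (z i)) / n| + 2 * ε := by
  have hn' : (0 : ℝ) < n := by exact_mod_cast hn
  have h1 : |(∫ x, h x ∂P) - ∫ x, h' x ∂P| ≤ ε := by
    rw [← integral_sub hi hi', ← Real.norm_eq_abs]
    simpa using norm_integral_le_of_norm_le_const (μ := P)
      (Eventually.of_forall fun x => (Real.norm_eq_abs _).trans_le (hε x))
  have h2 : |(∑ i, h' (z i)) / n - (∑ i, h (z i)) / n| ≤ ε := by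
    rw [← sub_div, ← Finset.sum_sub_distrib, abs_div, abs_of_pos hn', div_le_iff₀ hn']
    refine (Finset.abs_sum_le_sum_abs _ _).trans ?_
    refine (Finset.sum_le_sum fun i _ => (abs_sub_comm _ _).trans_le (hε (z i))).trans_eq ?_
    simp [mul_comm]
  have e : (∫ x, h x ∂P) - (∑ i, h (z i)) / n = ((∫ x, h' x ∂P) - (∑ i, h' (z i)) / n) +
      (((∫ x, h x ∂P) - ∫ x, h' x ∂P) + ((∑ i, h' (z i)) / n - (∑ i, h (z i)) / n)) := by ring
  rw [e]
  refine (abs_add_le _ _).trans (add_le_add_right ((abs_add_le _ _).trans ?_) _)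
  linarith

end

section

variable {p : SymmetricDensity} {s : ℝ≥0} {σ : ℝ} {Θ : Set ℝ}

theorem GmmkRKHS.integrable_hinge (Q : Measure (Θ × Label)) [IsFiniteMeasure Q]
    (f : GmmkRKHS p s σ Θ) : Integrable (fun z : Θ × Label => hinge z.2 (f z.1)) Q :=
  integrable_hinge_comp Q f.continuous_coe f.abs_apply_le

theorem risk_nonneg (Q : Measure (Θ × Label)) (f : GmmkRKHS p s σ Θ) : 0 ≤ risk Q f :=
  integral_nonneg fun _ => hinge_nonneg _ _

theorem bddBelow_range_risk (Q : Measure (Θ × Label)) :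
    BddBelow (Set.range fun f : GmmkRKHS p s σ Θ => risk Q f) :=
  ⟨0, by rintro _ ⟨f, rfl⟩; exact risk_nonneg Q f⟩

theorem risk_zero (Q : Measure (Θ × Label)) [IsProbabilityMeasure Q] :
    risk Q (0 : GmmkRKHS p s σ Θ) = 1 := by
  simp [risk, hinge]

theorem continuous_risk (Q : Measure (Θ × Label)) [IsProbabilityMeasure Q] :
    Continuous fun f : GmmkRKHS p s σ Θ => risk Q f := by
  refine LipschitzWith.continuous (K := (√(locKernel p s σ 0 0)).toNNReal)
    (LipschitzWith.of_dist_le_mul fun f g => ?_)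
  rw [Real.dist_eq, risk, risk, ← integral_sub (f.integrable_hinge Q) (g.integrable_hinge Q),
    ← Real.norm_eq_abs, Real.coe_toNNReal _ (Real.sqrt_nonneg _), dist_eq_norm]
  refine (norm_integral_le_of_norm_le_const (μ := Q) (Eventually.of_forall fun z =>
    ((abs_hinge_sub_hinge_le z.2 _ _).trans ?_))).trans_eq (by simp; rfl)
  have := (f - g).abs_apply_le z.1
  rwa [RKHS.coe_sub, Pi.sub_apply] at this

theorem risk_midpoint_le (Q : Measure (Θ × Label)) [IsProbabilityMeasure Q]
    (f g : GmmkRKHS p s σ Θ) :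
    risk Q ((1 / 2 : ℝ) • (f + g)) ≤ (risk Q f + risk Q g) / 2 := by
  have hf := f.integrable_hinge Q
  have hg := g.integrable_hinge Q
  simp only [risk]
  rw [← integral_add hf hg, ← integral_div]
  refine integral_mono (GmmkRKHS.integrable_hinge Q _) ((hf.add hg).div_const 2) fun z => ?_
  simp only [RKHS.coe_smul, RKHS.coe_add, Pi.smul_apply, Pi.add_apply, smul_eq_mul]
  exact hinge_midpoint_le _ _ _

theorem existsUnique_isSVMSolution (Q : Measure (Θ × Label)) [IsProbabilityMeasure Q] {reg : ℝ}
    (hreg : 0 < reg) : ∃! f : GmmkRKHS p s σ Θ, IsSVMSolution reg Q f :=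
  existsUnique_minimizer_sq_norm_add (continuous_risk Q) (risk_nonneg Q) (risk_midpoint_le Q) hreg

/-- The competitor 0 has regularized risk 1. -/
theorem IsSVMSolution.sqrt_mul_norm_le {Q : Measure (Θ × Label)} [IsProbabilityMeasure Q] {reg : ℝ}
    (hreg : 0 < reg) {f : GmmkRKHS p s σ Θ} (hf : IsSVMSolution reg Q f) : √reg * ‖f‖ ≤ 1 := by
  have h := hf 0
  simp only [regRisk, risk_zero, norm_zero] at h
  have h2 : (√reg * ‖f‖) ^ 2 ≤ 1 := by
    rw [mul_pow, Real.sq_sqrt hreg.le]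
    linarith [risk_nonneg Q f]
  nlinarith [mul_nonneg (Real.sqrt_nonneg reg) (norm_nonneg f)]

/-- The reference risk is the infimum over the RKHS itself, so no density in `C(Θ)` is required: the
penalty of one fixed near-optimal function tends to 0. -/
theorem tendsto_approxError (Q : Measure (Θ × Label)) :
    Tendsto (approxError p s σ Q) (𝓝[>] 0) (𝓝 0) := by
  have hmin : ∀ f : GmmkRKHS p s σ Θ, minRisk p s σ Q ≤ risk Q f :=
    fun f => ciInf_le (bddBelow_range_risk Q) f
  have hterm : ∀ reg > 0, ∀ f : GmmkRKHS p s σ Θ, 0 ≤ regRisk reg Q f - minRisk p s σ Q :=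
    fun reg hreg f => by
      have : 0 ≤ reg * ‖f‖ ^ 2 := by positivity
      have := hmin f
      unfold regRisk
      linarith
  rw [Metric.tendsto_nhds]
  intro δ hδ
  obtain ⟨f, hf⟩ := exists_lt_of_ciInf_lt
    (show (⨅ f : GmmkRKHS p s σ Θ, risk Q f) < minRisk p s σ Q + δ / 2 from
      lt_add_of_pos_right _ (by positivity))
  have ht : Tendsto (fun reg : ℝ => reg * ‖f‖ ^ 2) (𝓝[>] 0) (𝓝 0) := by
    have : Continuous fun reg : ℝ => reg * ‖f‖ ^ 2 := by fun_prop
    simpa using (this.tendsto 0).mono_left nhdsWithin_le_nhds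
  filter_upwards [ht.eventually_lt_const (show (0 : ℝ) < δ / 2 by positivity),
    self_mem_nhdsWithin] with reg h1 hreg
  have h2 : approxError p s σ Q reg ≤ regRisk reg Q f - minRisk p s σ Q :=
    ciInf_le ⟨0, by rintro _ ⟨f, rfl⟩; exact hterm reg hreg f⟩ f
  have h3 : 0 ≤ approxError p s σ Q reg := Real.iInf_nonneg fun f => hterm reg hreg f
  rw [Real.dist_eq, sub_zero, abs_of_nonneg h3]
  unfold regRisk at h2
  linarith

/-! ### The oracle inequality. -/

theorem exists_finset_cover [CompactSpace Θ] {η : ℝ} (hη : 0 ≤ η)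
    (h : ballCoveringNumber p s σ Θ η ≠ ⊤) :
    ∃ T : Finset C(Θ, ℝ), T.card ≤ (ballCoveringNumber p s σ Θ η).toNat ∧
      ∀ f : GmmkRKHS p s σ Θ, ‖f‖ ≤ 1 → ∃ g ∈ T, ∀ x, |f x - g x| ≤ η := by
  have hlt : ballCoveringNumber p s σ Θ η < ballCoveringNumber p s σ Θ η + 1 :=
    (ENat.lt_add_one_iff h).2 le_rfl
  conv_lhs at hlt => rw [ballCoveringNumber, Metric.externalCoveringNumber]
  simp only [iInf_lt_iff] at hlt
  obtain ⟨S, hS, hcard⟩ := hlt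
  have hcard' := (ENat.lt_add_one_iff h).1 hcard
  have hfin : S.Finite := Set.encard_ne_top_iff.1 (ne_top_of_le_ne_top h hcard')
  refine ⟨hfin.toFinset, ?_, fun f hf => ?_⟩
  · rw [hfin.encard_eq_coe_toFinset_card] at hcard'
    exact_mod_cast hcard'.trans_eq (ENat.natCast_toNat h).symm
  · obtain ⟨g, hg, hfg⟩ := hS (x := inclusion f) ⟨f, by simpa using hf, rfl⟩
    refine ⟨g, by simpa using hg, fun x => ?_⟩
    have h1 : edist (inclusion f) g ≤ ENNReal.ofReal η := hfg
    rw [edist_dist, ENNReal.ofReal_le_ofReal_iff hη] at h1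
    exact (ContinuousMap.dist_apply_le_dist x).trans h1

/-- The oracle inequality for a sample on which all the functions in a net have small deviation. -/
theorem regRisk_sub_minRisk_le (P : Measure (Θ × Label)) [IsProbabilityMeasure P] {reg : ℝ}
    (hreg : 0 < reg) {n : ℕ} (hn : 1 ≤ n) {z : Fin n → Θ × Label} {d : ℝ}
    (hd : ∀ f : GmmkRKHS p s σ Θ, √reg * ‖f‖ ≤ 1 → |risk P f - risk (empirical z) f| < d)
    {f : GmmkRKHS p s σ Θ} (hf : IsSVMSolution reg (empirical z) f) :
    regRisk reg P f - minRisk p s σ P < approxError p s σ P reg + 2 * d := by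
  have := isProbabilityMeasure_empirical hn z
  -- The population minimizer obeys the same norm bound as `f`, so the uniform deviation applies to
  -- both; hence `2 * d`.
  obtain ⟨g, hg, -⟩ := existsUnique_isSVMSolution (p := p) (s := s) (σ := σ) P hreg
  have h1 : regRisk reg P g - minRisk p s σ P ≤ approxError p s σ P reg :=
    le_ciInf fun h => sub_le_sub_right (hg h) _
  have h2 := (abs_lt.1 (hd f (hf.sqrt_mul_norm_le hreg))).2
  have h3 := (abs_lt.1 (hd g (hg.sqrt_mul_norm_le hreg))).1
  have h4 := hf g
  unfold regRisk at *
  linarith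

/-- The free parameter `v` lets one argument serve both the covering number and its logarithmic
bound. The bad set is only included in a finite union of deviation events, so its own measurability
plays no role. -/
theorem measure_not_oracle_lt [CompactSpace Θ] (hk : locKernel p s σ 0 0 < 1)
    (P : Measure (Θ × Label)) [IsProbabilityMeasure P] {reg ε τ : ℝ} {n : ℕ} (hreg : 0 < reg)
    (hn : 1 ≤ n) (hε : 0 < ε) (hτ : 0 < τ)
    (hN : ballCoveringNumber p s σ Θ (√reg * ε) ≠ ⊤) {v : ℝ}
    (hv : 2 * τ + 2 * Real.log (2 * (ballCoveringNumber p s σ Θ (√reg * ε)).toNat) ≤ v) :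
    Measure.pi (fun _ : Fin n => P)
      {z | ¬ ∀ f : GmmkRKHS p s σ Θ, IsSVMSolution reg (empirical z) f →
        regRisk reg P f - minRisk p s σ P <
          approxError p s σ P reg + 4 * ε + (1 / √reg + 1) * √(v / n)}
      < ENNReal.ofReal (Real.exp (-τ)) := by
  have hsr : 0 < √reg := Real.sqrt_pos.2 hreg
  have hn' : (0 : ℝ) < n := by exact_mod_cast hn
  set N := (ballCoveringNumber p s σ Θ (√reg * ε)).toNat with hNdef
  obtain ⟨T, hTcard, hT⟩ := exists_finset_cover (p := p) (s := s) (σ := σ) (Θ := Θ)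
    (by positivity) hN
  have hN1 : (1 : ℝ) ≤ N := by
    obtain ⟨g, hg, -⟩ := hT 0 (by simp)
    exact_mod_cast (Finset.card_pos.2 ⟨g, hg⟩).trans_le hTcard
  have hlogN : 0 ≤ Real.log (2 * N) := Real.log_nonneg (by linarith)
  set M := √(locKernel p s σ 0 0) / √reg with hM
  have hM0 : 0 ≤ M := by positivity
  have hMlt : 1 + M < 1 / √reg + 1 := by
    have : √(locKernel p s σ 0 0) < 1 := (Real.sqrt_lt' one_pos).2 (by simpa using hk)
    have : M < 1 / √reg := by rw [hM]; gcongr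
    linarith
  set t := (1 / √reg + 1) * √(v / n) / 2 with ht
  have ht0 : 0 ≤ t := by positivity
  -- Centres of the cover are arbitrary continuous functions, without a usable sup bound. Clipping
  -- at `M` confines the loss to `[0, 1 + M]`; it is 1-Lipschitz and fixes the relevant `f`, so the
  -- distance does not grow.
  let h : C(Θ, ℝ) → Θ × Label → ℝ := fun g z => hinge z.2 (max (min (g z.1 / √reg) M) (-M))
  have hclip : ∀ a : ℝ, |max (min a M) (-M)| ≤ M := fun a =>
    abs_le.2 ⟨le_max_right _ _, max_le (min_le_right _ _) (by linarith)⟩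
  have hcont : ∀ g : C(Θ, ℝ), Continuous fun x => max (min (g x / √reg) M) (-M) :=
    fun g => by fun_prop
  have hmeas : ∀ g, Measurable (h g) := fun g => measurable_hinge_comp (hcont g)
  have hrange : ∀ g z, h g z ∈ Set.Icc 0 (1 + M) :=
    fun g z => ⟨hinge_nonneg _ _, hinge_le z.2 (hclip _)⟩
  have hint : ∀ g, Integrable (h g) P := fun g =>
    integrable_hinge_comp P (hcont g) fun x => hclip _
  set E : C(Θ, ℝ) → Set (Fin n → Θ × Label) := fun g =>
    {z | t ≤ |(∫ x, h g x ∂P) - (∑ i, h g (z i)) / n|} with hE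
  set μ := Measure.pi (fun _ : Fin n => P)
  have hsub : {z | ¬ ∀ f : GmmkRKHS p s σ Θ, IsSVMSolution reg (empirical z) f →
        regRisk reg P f - minRisk p s σ P <
          approxError p s σ P reg + 4 * ε + (1 / √reg + 1) * √(v / n)} ⊆ ⋃ g ∈ T, E g := by
    intro z hz
    by_contra hzE
    refine hz fun f hf => ?_
    simp only [hE, Set.mem_iUnion, not_exists, Set.mem_ofPred_eq, not_le] at hzE
    have := regRisk_sub_minRisk_le P hreg hn (d := t + 2 * ε) (fun f hf => ?_) hf
    · refine this.trans_eq ?_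
      rw [ht]; ring
    · have hfn : ‖√reg • f‖ ≤ 1 := by rwa [norm_smul, Real.norm_of_nonneg hsr.le]
      obtain ⟨g, hg, hfg⟩ := hT _ hfn
      have hdev : ∀ x : Θ × Label, |hinge x.2 (f x.1) - h g x| ≤ ε := by
        intro x
        have hfM : |f x.1| ≤ M := by
          refine (f.abs_apply_le x.1).trans ?_
          rw [hM, le_div_iff₀ hsr, mul_assoc]
          refine mul_le_of_le_one_right (Real.sqrt_nonneg _) ?_
          rwa [mul_comm]
        have hff : f x.1 = max (min (f x.1) M) (-M) := by
          rw [min_eq_left (abs_le.1 hfM).2, max_eq_left (abs_le.1 hfM).1]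
        refine (abs_hinge_sub_hinge_le x.2 _ _).trans ?_
        rw [hff]
        refine (abs_max_sub_max_le_abs _ _ _).trans ((abs_min_sub_min_le_max _ _ _ _).trans ?_)
        rw [sub_self, abs_zero, max_eq_left (abs_nonneg _)]
        have h1 := hfg x.1
        rw [RKHS.coe_smul, Pi.smul_apply, smul_eq_mul] at h1
        have e : f x.1 - g x.1 / √reg = (√reg * f x.1 - g x.1) / √reg := by field_simp
        rw [e, abs_div, abs_of_pos hsr, div_le_iff₀ hsr, mul_comm ε]
        exact h1
      have h2 := abs_integral_sub_sum_le P hn z (f.integrable_hinge P) (hint g) hdev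
      rw [risk, risk, integral_empirical]
      linarith [hzE g hg]
  have hexp : ∀ g, μ.real (E g) < Real.exp (-τ) / N := by
    intro g
    refine (hoeffding_two_sided P (hmeas g) (by linarith) (hrange g) hn ht0).trans_lt ?_
    have hv0 : 0 < v := by linarith
    have e1 : 2 * n * t ^ 2 / (1 + M - 0) ^ 2 =
        ((1 / √reg + 1) / (1 + M)) ^ 2 * (v / 2) := by
      rw [ht, sub_zero, div_pow, mul_pow, Real.sq_sqrt (by positivity), div_pow]
      field_simp
    -- Strictness of the final probability bound comes from here: `k(0,0) < 1` makes the loss range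
    -- `1 + M` smaller than `1 / √reg + 1`.
    have e2 : 1 < ((1 / √reg + 1) / (1 + M)) ^ 2 :=
      one_lt_pow₀ ((one_lt_div (by positivity)).2 hMlt) two_ne_zero
    have e3 : τ + Real.log (2 * N) < 2 * n * t ^ 2 / (1 + M - 0) ^ 2 := by
      rw [e1]
      nlinarith
    calc _ < 2 * Real.exp (-(τ + Real.log (2 * N))) := by gcongr
      _ = _ := by
        rw [neg_add, Real.exp_add, Real.exp_neg (Real.log _), Real.exp_log (by positivity)]
        field_simp
  have hTne : T.Nonempty := by
    obtain ⟨g, hg, -⟩ := hT 0 (by simp)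
    exact ⟨g, hg⟩
  have hreal : μ.real (⋃ g ∈ T, E g) < Real.exp (-τ) := by
    calc _ ≤ ∑ g ∈ T, μ.real (E g) := measureReal_biUnion_finset_le _ _
      _ < ∑ _g ∈ T, Real.exp (-τ) / N := Finset.sum_lt_sum_of_nonempty hTne fun g _ => hexp g
      _ = T.card * (Real.exp (-τ) / N) := by rw [Finset.sum_const, nsmul_eq_mul]
      _ ≤ N * (Real.exp (-τ) / N) := by
          gcongr
      _ = _ := by field_simp
  refine (measure_mono hsub).trans_lt ?_
  rw [← ofReal_measureReal (h := measure_ne_top μ _)]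
  exact (ENNReal.ofReal_lt_ofReal_iff (Real.exp_pos _)).2 hreal

end

theorem mainTheorem6 (p : SymmetricDensity) (s : ℝ≥0) (σ : ℝ) (hσ : 0 < σ)
    (hs : s ≤ 1 ∨ locKernel p s σ 0 0 < 1) (Θ : Set ℝ) [CompactSpace Θ] :
    ∃ c : ℝ, 0 < c ∧
      (∀ reg ε : ℝ, 0 < reg → 0 < ε →
        ballCoveringNumber p s σ Θ (√reg * ε) ≠ ⊤ ∧
        Real.log (ballCoveringNumber p s σ Θ (√reg * ε)).toNat
          ≤ c * Real.log (1 / (√reg * ε)) ^ 2) ∧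
      ∀ (P : Measure (Θ × Label)) [IsProbabilityMeasure P],
        Tendsto (approxError p s σ P) (𝓝[>] 0) (𝓝 0) ∧
        ∀ (reg : ℝ) (n : ℕ), 0 < reg → 1 ≤ n →
          (∀ z : Fin n → Θ × Label, ∃! f : GmmkRKHS p s σ Θ, IsSVMSolution reg (empirical z) f) ∧
          ∀ ε τ : ℝ, 0 < ε → 0 < τ →
            Measure.pi (fun _ : Fin n => P)
              {z | ¬ ∀ f : GmmkRKHS p s σ Θ, IsSVMSolution reg (empirical z) f →
                regRisk reg P f - minRisk p s σ P <
                  approxError p s σ P reg + 4 * ε + (1 / √reg + 1) *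
                    √((2 * τ + 2 * Real.log
                      (2 * (ballCoveringNumber p s σ Θ (√reg * ε)).toNat)) / n)}
              < ENNReal.ofReal (Real.exp (-τ)) ∧
            Measure.pi (fun _ : Fin n => P)
              {z | ¬ ∀ f : GmmkRKHS p s σ Θ, IsSVMSolution reg (empirical z) f →
                regRisk reg P f - minRisk p s σ P <
                  approxError p s σ P reg + 4 * ε + (1 / √reg + 1) *
                    √((2 * τ + 2 * Real.log 2
                      + 2 * c * Real.log (1 / (√reg * ε)) ^ 2) / n)}
              < ENNReal.ofReal (Real.exp (-τ)) := by
  have hk : locKernel p s σ 0 0 < 1 := hs.elim (locKernel_zero_lt_one p hσ) id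
  obtain ⟨c, hc, hcov⟩ := GmmkRKHS.exists_log_ballCoveringNumber_le p s σ hk Θ
  have hη : ∀ {reg ε : ℝ}, 0 < reg → 0 < ε → 0 < √reg * ε := fun hr he =>
    mul_pos (Real.sqrt_pos.2 hr) he
  refine ⟨c, hc, fun reg ε hreg hε => hcov _ (hη hreg hε), fun P _ =>
    ⟨tendsto_approxError P, fun reg n hreg hn => ⟨fun z => ?_, fun ε τ hε hτ => ?_⟩⟩⟩
  · have := isProbabilityMeasure_empirical hn z
    exact existsUnique_isSVMSolution _ hreg
  · obtain ⟨htop, hlog⟩ := hcov _ (hη hreg hε)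
    refine ⟨measure_not_oracle_lt hk P hreg hn hε hτ htop le_rfl,
      measure_not_oracle_lt hk P hreg hn hε hτ htop ?_⟩
    -- Nonvanishing is needed to split `log (2 * N)` before inserting the entropy bound.
    have hN : ((ballCoveringNumber p s σ Θ (√reg * ε)).toNat : ℝ) ≠ 0 := by
      rw [Nat.cast_ne_zero, Ne, ENat.toNat_eq_zero]
      exact not_or.2 ⟨(GmmkRKHS.ballCoveringNumber_pos _).ne', htop⟩
    rw [Real.log_mul two_ne_zero hN]
    linarith
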